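/- Let $G$ be a connected semisimple real Lie group with finite center, let $K\subset G$ be a maximal compact subgroup, and let $(\tau,V)$ be an irreducible unitary representation of $K$ (it is automatically finite dimensional, since $K$ is compact). Let $E_\tau=(G\times V)/K$ be the associated $G$-equivariant vector bundle over $X=G/K$, where $K$ acts on $G\times V$ from the right by $(g,v)k=(gk,\tau(k)^{-1}v)$, and let $G$ act on the space $\Gamma^\infty(E_\tau)$ of smooth sections by $(g.s)(x)=g\,s(g^{-1}x)$. Let $\mathcal{D}_\tau$ be the set of all $G$-invariant differential operators on $E_\tau$, i.e. of all linear differential operators $D:\Gamma^\infty(E_\tau)\to\Gamma^\infty(E_\tau)$ with $D(g.s)=g.D(s)$ for all $g\in G$ and $s\in\Gamma^\infty(E_\tau)$. Then $\mathcal{D}_\tau$ is a subalgebra of $\mathrm{End}_{\mathbb{C}}(\Gamma^\infty(E_\tau))$, and it is finitely generated as a $\mathbb{C}$-algebra. -/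

import Mathlib

open scoped Manifold ContDiff

noncomputable section

namespace InvDiffOp

section LieGroups

variable (E : Type*) [NormedAddCommGroup E] [NormedSpace ℝ E] [FiniteDimensional ℝ E]
variable (G : Type*) [TopologicalSpace G] [ChartedSpace E G] [Group G] [LieGroup 𝓘(ℝ, E) ∞ G]

/-- A finite-dimensional real Lie group is semisimple if its Lie algebra (the tangent space at the
identity with the bracket of left-invariant vector fields) is semisimple. -/
def IsSemisimpleLieGroup : Prop :=
  haveI : LieGroup 𝓘(ℝ, E) (minSmoothness ℝ 3) G :=
    LieGroup.of_le (n := ∞) (by simpa using ENat.LEInfty.out)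
  haveI : CompleteSpace E := FiniteDimensional.complete ℝ E
  LieAlgebra.IsSemisimple ℝ (GroupLieAlgebra 𝓘(ℝ, E) G)

end LieGroups

variable {G : Type*} [Group G] {K : Subgroup G}
variable {V : Type*} [NormedAddCommGroup V] [InnerProductSpace ℂ V]

/-- A homomorphism `τ` from `K` to the unitary group of a Hilbert space `V` is an irreducible
unitary representation: it is strongly continuous, `V ≠ 0`, and `0` and `V` are the only closed
invariant subspaces. -/
structure IsIrreducibleUnitaryRep [TopologicalSpace G] (τ : K →* (V ≃ₗᵢ[ℂ] V)) : Prop where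
  continuous_apply : ∀ v : V, Continuous fun k : K => τ k v
  nontrivial : Nontrivial V
  eq_bot_or_eq_top : ∀ W : Submodule ℂ V, IsClosed (W : Set V) →
    (∀ k : K, ∀ w ∈ W, τ k w ∈ W) → W = ⊥ ∨ W = ⊤

lemma rep_mul (τ : K →* (V ≃ₗᵢ[ℂ] V)) (k l : K) (v : V) : τ (k * l) v = τ k (τ l v) := by
  rw [map_mul]
  rfl

/-! ### The equivariant vector bundle `E_τ = (G × V) / K` over `G / K` -/

/-- The orbit relation of the right action `(g, v) k = (g k, τ(k)⁻¹ v)` of `K` on `G × V`. -/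
def bundleSetoid (τ : K →* (V ≃ₗᵢ[ℂ] V)) : Setoid (G × V) where
  r p q := ∃ k : K, q.1 = p.1 * k ∧ q.2 = τ k⁻¹ p.2
  iseqv :=
    { refl := fun p => ⟨1, by simp, by simp⟩
      symm := by
        rintro p q ⟨k, h1, h2⟩
        refine ⟨k⁻¹, by simp [h1], ?_⟩
        rw [h2, ← rep_mul]
        simp
      trans := by
        rintro p q r ⟨k, h1, h2⟩ ⟨l, h3, h4⟩
        refine ⟨k * l, by simp [h1, h3, mul_assoc], ?_⟩
        rw [h4, h2, ← rep_mul, mul_inv_rev] }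

/-- The total space of `E_τ`. -/
def AssocBundle (τ : K →* (V ≃ₗᵢ[ℂ] V)) : Type _ := Quotient (bundleSetoid τ)

namespace AssocBundle

variable (τ : K →* (V ≃ₗᵢ[ℂ] V))

/-- The class `[g, v]` in `E_τ`. -/
def mk (g : G) (v : V) : AssocBundle τ := Quotient.mk (bundleSetoid τ) (g, v)

/-- The projection `E_τ → G / K`, `[g, v] ↦ gK`. -/
def proj : AssocBundle τ → G ⧸ K :=
  Quotient.lift (fun p : G × V => (p.1 : G ⧸ K)) (by
    rintro p q ⟨k, h1, -⟩
    exact QuotientGroup.eq.2 (by simp [h1]))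

/-- The action of `G` on `E_τ`, `g [h, v] = [g h, v]`. -/
def act (g : G) : AssocBundle τ → AssocBundle τ :=
  Quotient.map (fun p : G × V => (g * p.1, p.2)) (by
    rintro p q ⟨k, h1, h2⟩
    exact ⟨k, by simp [h1, mul_assoc], h2⟩)

@[simp] lemma proj_mk (g : G) (v : V) : proj τ (mk τ g v) = (g : G ⧸ K) := rfl

@[simp] lemma act_mk (g h : G) (v : V) : act τ g (mk τ h v) = mk τ (g * h) v := rfl

lemma proj_act (g : G) (e : AssocBundle τ) : proj τ (act τ g e) = g • proj τ e := by
  induction e using Quotient.inductionOn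
  rfl

lemma mk_mul (g : G) (k : K) (v : V) : mk τ (g * k) v = mk τ g (τ k v) := by
  refine (Quotient.sound (s := bundleSetoid τ) ⟨k, rfl, ?_⟩).symm
  change v = τ k⁻¹ (τ k v)
  rw [← rep_mul]
  simp

lemma mk_injective (g : G) : Function.Injective (mk τ g) := by
  intro v w h
  obtain ⟨k, h1, h2⟩ := Quotient.exact (s := bundleSetoid τ) h
  have hk : k = 1 := by
    apply Subtype.ext
    simpa using h1
  subst hk
  simpa using h2.symm

/-- The fibre of `E_τ` over `x`. -/
def Fiber (x : G ⧸ K) : Type _ := {e : AssocBundle τ // proj τ e = x}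

/-- For `x = gK`, the bijection `v ↦ [g, v]` from `V` to the fibre over `x`. -/
def frame (g : G) (x : G ⧸ K) (h : (g : G ⧸ K) = x) : V ≃ Fiber τ x :=
  Equiv.ofBijective (fun v => ⟨mk τ g v, h⟩) (by
    constructor
    · intro v w hvw
      exact mk_injective τ g (congrArg Subtype.val hvw)
    · rintro ⟨e, he⟩
      induction e using Quotient.inductionOn with
      | h p =>
        obtain ⟨a, v⟩ := p
        have hk : g⁻¹ * a ∈ K := QuotientGroup.eq.1 (h.trans he.symm)
        refine ⟨τ ⟨g⁻¹ * a, hk⟩ v, Subtype.ext ?_⟩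
        change mk τ g (τ ⟨g⁻¹ * a, hk⟩ v) = mk τ a v
        rw [← mk_mul]
        simp)

lemma coe_frame (g : G) (x : G ⧸ K) (h : (g : G ⧸ K) = x) (v : V) :
    (frame τ g x h v).1 = mk τ g v := rfl

/-- The vector space structure of the fibres, transported from `V` along one of the bijections
`frame`; `frame_add` and `frame_smul` show that it does not depend on which one is used. -/
instance (x : G ⧸ K) : AddCommGroup (Fiber τ x) :=
  (frame τ x.out x (QuotientGroup.out_eq' x)).symm.addCommGroup

instance (x : G ⧸ K) : Module ℂ (Fiber τ x) :=
  (frame τ x.out x (QuotientGroup.out_eq' x)).symm.module ℂ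

lemma exists_frame_eq (g : G) (x : G ⧸ K) (h : (g : G ⧸ K) = x) :
    ∃ k : K, ∀ v, frame τ g x h v = frame τ x.out x (QuotientGroup.out_eq' x) (τ k v) := by
  have hk : x.out⁻¹ * g ∈ K := QuotientGroup.eq.1 ((QuotientGroup.out_eq' x).trans h.symm)
  refine ⟨⟨_, hk⟩, fun v => Subtype.ext ?_⟩
  rw [coe_frame, coe_frame, ← mk_mul]
  simp

lemma frame_add (g : G) (x : G ⧸ K) (h : (g : G ⧸ K) = x) (v w : V) :
    frame τ g x h (v + w) = frame τ g x h v + frame τ g x h w := by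
  obtain ⟨k, hk⟩ := exists_frame_eq τ g x h
  simp only [hk, map_add, Equiv.add_def, Equiv.symm_symm, Equiv.symm_apply_apply]

lemma frame_smul (g : G) (x : G ⧸ K) (h : (g : G ⧸ K) = x) (c : ℂ) (v : V) :
    frame τ g x h (c • v) = c • frame τ g x h v := by
  obtain ⟨k, hk⟩ := exists_frame_eq τ g x h
  simp only [hk, map_smul, Equiv.smul_def, Equiv.symm_symm, Equiv.symm_apply_apply]

/-- `frame` as a linear isomorphism. -/
def frameL (g : G) (x : G ⧸ K) (h : (g : G ⧸ K) = x) : V ≃ₗ[ℂ] Fiber τ x :=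
  { frame τ g x h with
    map_add' := frame_add τ g x h
    map_smul' := frame_smul τ g x h }

end AssocBundle

open AssocBundle

/-! ### Smooth sections -/

/-- The function `f : G → V` that describes a section `s` of `E_τ`: `s(gK) = [g, f(g)]`. -/
def pullback (τ : K →* (V ≃ₗᵢ[ℂ] V)) (s : (x : G ⧸ K) → Fiber τ x) (g : G) : V :=
  (frameL τ g (g : G ⧸ K) rfl).symm (s g)

lemma mk_pullback (τ : K →* (V ≃ₗᵢ[ℂ] V)) (s : (x : G ⧸ K) → Fiber τ x) (g : G) :
    mk τ g (pullback τ s g) = (s g).1 :=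
  congrArg Subtype.val ((frameL τ g (g : G ⧸ K) rfl).apply_symm_apply (s g))

/-- The translate `(g.s)(x) = g s(g⁻¹ x)` of a section. -/
def translate (τ : K →* (V ≃ₗᵢ[ℂ] V)) (g : G) (s : (x : G ⧸ K) → Fiber τ x) :
    (x : G ⧸ K) → Fiber τ x :=
  fun x => ⟨act τ g (s (g⁻¹ • x)).1, by rw [proj_act, (s (g⁻¹ • x)).2, smul_inv_smul]⟩

lemma pullback_translate (τ : K →* (V ≃ₗᵢ[ℂ] V)) (g : G) (s : (x : G ⧸ K) → Fiber τ x) (a : G) :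
    pullback τ (translate τ g s) a = pullback τ s (g⁻¹ * a) := by
  apply mk_injective τ a
  rw [mk_pullback]
  change act τ g (s ((g⁻¹ * a : G) : G ⧸ K)).1 = _
  rw [← mk_pullback, act_mk, mul_inv_cancel_left]

section Smooth

variable (E : Type*) [NormedAddCommGroup E] [NormedSpace ℝ E]
variable [TopologicalSpace G] [ChartedSpace E G]

/-- The space `Γ^∞(E_τ)` of smooth sections of `E_τ`. The smooth structures of `G / K` and `E_τ` are
the quotient ones (those for which `G → G / K` and `G × V → E_τ` are submersions), so a section `s`
is smooth if and only if the function `f : G → V` with `s(gK) = [g, f(g)]` is smooth. -/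
def SmoothSections (τ : K →* (V ≃ₗᵢ[ℂ] V)) : Submodule ℂ ((x : G ⧸ K) → Fiber τ x) where
  carrier := {s | ContMDiff 𝓘(ℝ, E) 𝓘(ℝ, V) ∞ (pullback τ s)}
  zero_mem' := by
    have h : pullback τ (0 : (x : G ⧸ K) → Fiber τ x) = fun _ => 0 := by
      funext g
      simp [pullback]
    rw [Set.mem_ofPred_eq, h]
    exact contMDiff_const
  add_mem' := by
    intro s t hs ht
    have h : pullback τ (s + t) = pullback τ s + pullback τ t := by
      funext g
      simp [pullback]
    rw [Set.mem_ofPred_eq, h]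
    exact ContMDiff.add hs ht
  smul_mem' := by
    intro c s hs
    have h : pullback τ (c • s) =
        ((c • ContinuousLinearMap.id ℂ V).restrictScalars ℝ) ∘ pullback τ s := by
      funext g
      simp [pullback]
    rw [Set.mem_ofPred_eq, h]
    exact (ContinuousLinearMap.contMDiff _).comp hs

/-- The action of `G` on `Γ^∞(E_τ)`. -/
def translateSmooth [LieGroup 𝓘(ℝ, E) ∞ G] (τ : K →* (V ≃ₗᵢ[ℂ] V)) (g : G)
    (s : SmoothSections E τ) : SmoothSections E τ :=
  ⟨translate τ g s.1, by
    change ContMDiff 𝓘(ℝ, E) 𝓘(ℝ, V) ∞ (pullback τ (translate τ g s.1))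
    have h : pullback τ (translate τ g s.1) = pullback τ s.1 ∘ (fun a => g⁻¹ * a) :=
      funext (pullback_translate τ g s.1)
    rw [h]
    exact ContMDiff.comp s.2 contMDiff_mul_left⟩

/-! ### Invariant differential operators -/

/-- The `n`-jet of a smooth function `f : G → V` at `g` is zero: in the chart at `g`, all
derivatives of order at most `n` vanish at `g`. -/
def JetVanishes (n : ℕ) (f : G → V) (g : G) : Prop :=
  ∀ j ≤ n, iteratedFDeriv ℝ j (f ∘ (chartAt E g).symm) (chartAt E g g) = 0

variable {E}

/-- A linear operator `D` on `Γ^∞(E_τ)` is a differential operator (of order at most `n`) if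
`(D s)(x)` depends only on the `n`-jet of `s` at `x`, for every section `s` and every point `x`.
As `G → G / K` is a submersion, the `n`-jet of `s` at `x = gK` vanishes if and only if the `n`-jet
at `g` of the corresponding function on `G` does. -/
def IsDifferentialOperator {τ : K →* (V ≃ₗᵢ[ℂ] V)}
    (D : Module.End ℂ (SmoothSections E τ)) : Prop :=
  ∃ n : ℕ, ∀ (s : SmoothSections E τ) (g : G),
    JetVanishes E n (pullback τ s.1) g → (D s).1 (g : G ⧸ K) = 0

/-- `D` is a `G`-invariant differential operator on `E_τ`, that is, an element of `𝒟_τ`. -/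
def IsInvariantDifferentialOperator [LieGroup 𝓘(ℝ, E) ∞ G] {τ : K →* (V ≃ₗᵢ[ℂ] V)}
    (D : Module.End ℂ (SmoothSections E τ)) : Prop :=
  IsDifferentialOperator D ∧
    ∀ (g : G) (s : SmoothSections E τ), D (translateSmooth E τ g s) = translateSmooth E τ g (D s)

end Smooth

end InvDiffOp

end

/-! Pulling sections back to `G` identifies them with the smooth `f : G → V` fixed by `(k f)(g) =
τ(k) f(g k)`. On all smooth functions `G → V` act the left-invariant differential operators
generated by `End V`, acting pointwise, and by a basis `X_i` of the left-invariant vector fields.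
The group `K` acts on these operators by conjugation, and its invariants preserve the fixed
functions.

Every invariant `D` arises this way (`exists_toSections_eq`). The value `(D s)(1)` depends linearly
on the `n`-jet at `1`, and finitely many monomials in the `X_i` detect that jet. So some
left-invariant operator `a` computes `(D s)(1)`. Averaging `a` over `K` keeps the value at `1`, and
left invariance carries the identity to all of `G`. Thus `𝒟_τ` is a homomorphic image of the algebra
of `K`-invariants.

That algebra is finitely generated by Hilbert's argument (`fg_filInvariants`). The `X_i` commute
with `End V`, and their commutators have order at most one. Hence they act by commuting operators on
the graded module of the order filtration. This module is generated by its degree-zero part, a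
quotient of a finite-dimensional space, so it is Noetherian over the commutative algebra of these
operators (`isNoetherian_gr`). Finitely many positive-degree invariants therefore generate all of
them up to lower order with arbitrary coefficients; Haar averaging makes the coefficients invariant,
and induction on the order concludes. -/

noncomputable section

namespace InvDiffOp

open MeasureTheory

/-! ### Continuous functions of finite rank -/

section Averaging

variable (K : Type*) [TopologicalSpace K] {W : Type*} [Ring W] [Algebra ℂ W]

/-- The functions `K → W` that are finite sums of functions `k ↦ c k • e` with `c` continuous and
`e ∈ U`. -/
def finiteFunctions (U : Submodule ℂ W) : Submodule ℂ (K → W) :=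
  Submodule.span ℂ {F | ∃ c : K → ℂ, Continuous c ∧ ∃ e ∈ U, F = fun k => c k • e}

variable {K}

lemma smul_mem_finiteFunctions {U : Submodule ℂ W} {c : K → ℂ} (hc : Continuous c) {e : W}
    (he : e ∈ U) : (fun k => c k • e) ∈ finiteFunctions K U :=
  Submodule.subset_span ⟨c, hc, e, he, rfl⟩

lemma finiteFunctions_mono {U U' : Submodule ℂ W} (h : U ≤ U') :
    finiteFunctions K U ≤ finiteFunctions K U' :=
  Submodule.span_mono fun _ ⟨c, hc, e, he, hF⟩ => ⟨c, hc, e, h he, hF⟩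

lemma mul_mem_finiteFunctions {U U' U'' : Submodule ℂ W}
    (h : ∀ a ∈ U, ∀ b ∈ U', a * b ∈ U'') {F F' : K → W}
    (hF : F ∈ finiteFunctions K U) (hF' : F' ∈ finiteFunctions K U') :
    F * F' ∈ finiteFunctions K U'' := by
  have := Submodule.mul_mem_mul hF hF'
  rw [finiteFunctions, finiteFunctions, Submodule.span_mul_span] at this
  refine Submodule.span_le.2 ?_ this
  rintro _ ⟨_, ⟨c, hc, e, he, rfl⟩, _, ⟨c', hc', e', he', rfl⟩, rfl⟩
  refine Submodule.subset_span ⟨c * c', hc.mul hc', e * e', h _ he _ he', ?_⟩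
  funext k
  simp [smul_smul, mul_comm]

end Averaging

/-! ### Weak averages over a group -/

section Averaging

variable {K : Type*} [MeasurableSpace K] {W : Type*} [Ring W] [Algebra ℂ W] (μ : Measure K)

/-- `u` is the weak integral of `F` with respect to the probability measure `μ`. -/
def IsAverage (F : K → W) (u : W) : Prop :=
  ∀ φ : Module.Dual ℂ W, Integrable (fun k => φ (F k)) μ ∧ φ u = ∫ k, φ (F k) ∂μ

variable {μ}

lemma IsAverage.add {F F' : K → W} {u u' : W} (h : IsAverage μ F u) (h' : IsAverage μ F' u') :
    IsAverage μ (F + F') (u + u') := fun φ => by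
  simp only [Pi.add_apply, map_add]
  refine ⟨(h φ).1.add (h' φ).1, ?_⟩
  rw [integral_add (h φ).1 (h' φ).1, (h φ).2, (h' φ).2]

lemma IsAverage.smul {F : K → W} {u : W} (h : IsAverage μ F u) (c : ℂ) :
    IsAverage μ (c • F) (c • u) := fun φ => by
  simp only [Pi.smul_apply, map_smul]
  refine ⟨(h φ).1.smul c, ?_⟩
  rw [integral_smul, (h φ).2]

lemma IsAverage.zero : IsAverage μ (0 : K → W) 0 := fun φ => by simp

lemma IsAverage.map {F : K → W} {u : W} (h : IsAverage μ F u) (T : W →ₗ[ℂ] W) :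
    IsAverage μ (fun k => T (F k)) (T u) := fun φ => h (φ ∘ₗ T)

/-- The full algebraic dual separates points, so no topology on `W` is needed. -/
lemma IsAverage.unique {F : K → W} {u u' : W} (h : IsAverage μ F u) (h' : IsAverage μ F u') :
    u = u' := by
  rw [← sub_eq_zero, ← Module.forall_dual_apply_eq_zero_iff ℂ]
  intro φ
  rw [map_sub, (h φ).2, (h' φ).2, sub_self]

lemma IsAverage.const [IsProbabilityMeasure μ] (u : W) : IsAverage μ (fun _ => u) u := fun φ => by
  simp

/-- A term `c • e` has average `(∫ c) • e`, which stays in `U`; averages add up over finite sums. -/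
lemma exists_isAverage [TopologicalSpace K] [CompactSpace K] [OpensMeasurableSpace K]
    [IsFiniteMeasure μ]
    {U : Submodule ℂ W} {F : K → W} (hF : F ∈ finiteFunctions K U) :
    ∃ u ∈ U, IsAverage μ F u := by
  refine Submodule.span_induction ?_ ⟨0, U.zero_mem, .zero⟩ ?_ ?_ hF
  · rintro _ ⟨c, hc, e, he, rfl⟩
    refine ⟨(∫ k, c k ∂μ) • e, U.smul_mem _ he, fun φ => ⟨?_, ?_⟩⟩
    · simp only [map_smul]
      exact (hc.smul continuous_const).integrable_of_hasCompactSupport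
        (HasCompactSupport.of_compactSpace _)
    · simp only [map_smul]
      rw [integral_smul_const]
  · rintro _ _ _ _ ⟨u, hu, h⟩ ⟨u', hu', h'⟩
    exact ⟨u + u', U.add_mem hu hu', h.add h'⟩
  · rintro c _ _ ⟨u, hu, h⟩
    exact ⟨c • u, U.smul_mem c hu, h.smul c⟩

/-- By left invariance of `μ`, both `σ k u` and `u` are averages of `l ↦ σ (k * l) a`. -/
lemma IsAverage.apply_eq [Group K] [MeasurableMul K] [μ.IsMulLeftInvariant]
    {σ : K →* (W →ₐ[ℂ] W)} {a u : W} (h : IsAverage μ (fun k => σ k a) u) (k : K) :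
    σ k u = u := by
  refine (h.map (σ k).toLinearMap).unique fun φ => ?_
  have e : ∀ l, φ ((σ k).toLinearMap (σ l a)) = φ (σ (k * l) a) := fun l => by
    rw [map_mul]; rfl
  simp only [e]
  exact ⟨(h φ).1.comp_mul_left k, by rw [integral_mul_left_eq_self (fun l => φ (σ l a)) k, (h φ).2]⟩

end Averaging

/-! ### The order filtration -/

section Filtration

variable {W : Type*} [Ring W] [Algebra ℂ W] (M : Subalgebra ℂ W) {ι : Type*} (x : ι → W)

/-- The span of the products of at most `n` of the `x i` with an element of `M`. -/
def fil : ℕ → Submodule ℂ W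
  | 0 => Subalgebra.toSubmodule M
  | n + 1 => fil n ⊔ ⨆ i, (fil n).map (LinearMap.mulLeft ℂ (x i))

/-- The predecessor of `fil M x n`, with `⊥` for `n = 0`. -/
def filPred : ℕ → Submodule ℂ W
  | 0 => ⊥
  | n + 1 => fil M x n

variable {M x}

lemma fil_le_succ (n : ℕ) : fil M x n ≤ fil M x (n + 1) := le_sup_left

lemma fil_mono : Monotone (fil M x) := monotone_nat_of_le_succ fil_le_succ

lemma mul_mem_fil_succ (i : ι) {n : ℕ} {a : W} (ha : a ∈ fil M x n) :
    x i * a ∈ fil M x (n + 1) :=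
  le_sup_right (a := fil M x n) (Submodule.mem_iSup_of_mem i ⟨a, ha, rfl⟩)

lemma fil_succ_le {n : ℕ} {U : Submodule ℂ W} (h : fil M x n ≤ U)
    (h' : ∀ i, ∀ a ∈ fil M x n, x i * a ∈ U) : fil M x (n + 1) ≤ U :=
  sup_le h (iSup_le fun i => Submodule.map_le_iff_le_comap.2 fun a ha => h' i a ha)

lemma mem_fil_one (i : ι) : x i ∈ fil M x 1 := by
  simpa using mul_mem_fil_succ (n := 0) i (M.one_mem : (1 : W) ∈ fil M x 0)

/-- Left multiplication by `M` preserves every stage because it can be moved past the `x i`. The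
factors `x i` of `a` are then peeled off from the left, one at a time. -/
lemma mul_mem_fil (hM : ∀ i, ∀ a ∈ M, Commute (x i) a) {m n : ℕ} {a b : W}
    (ha : a ∈ fil M x m) (hb : b ∈ fil M x n) : a * b ∈ fil M x (m + n) := by
  have h0 : ∀ n, ∀ a ∈ M, fil M x n ≤ (fil M x n).comap (LinearMap.mulLeft ℂ a) := by
    intro n a ha
    induction n with
    | zero => exact fun b (hb : b ∈ M) => M.mul_mem ha hb
    | succ n ih =>
      refine fil_succ_le (fun b hb => fil_le_succ _ (ih hb)) fun i b hb => ?_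
      rw [Submodule.mem_comap, LinearMap.mulLeft_apply, ← mul_assoc, ← (hM i a ha).eq, mul_assoc]
      exact mul_mem_fil_succ i (ih hb)
  suffices h : fil M x m ≤ (fil M x (m + n)).comap (LinearMap.mulRight ℂ b) from h ha
  clear ha
  induction m with
  | zero => exact fun a ha => by simpa using h0 n a ha hb
  | succ m ih =>
    refine fil_succ_le (fun a ha => fil_mono (by omega) (ih ha)) fun i a ha => ?_
    rw [Submodule.mem_comap, LinearMap.mulRight_apply, mul_assoc, Nat.add_right_comm]
    exact mul_mem_fil_succ i (ih ha)

lemma mul_mem_filPred (i : ι) {n : ℕ} {a : W} (ha : a ∈ filPred M x n) :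
    x i * a ∈ filPred M x (n + 1) := by
  cases n with
  | zero =>
    obtain rfl : a = 0 := ha
    simp
  | succ n => exact mul_mem_fil_succ i ha

/-- Each `σ k` is multiplicative and products of finite-rank functions have finite rank, so it is
enough to control the orbits of the generators. -/
lemma mem_finiteFunctions_fil {K : Type*} [TopologicalSpace K] [Group K] {σ : K →* (W →ₐ[ℂ] W)}
    (hM : ∀ i, ∀ a ∈ M, Commute (x i) a)
    (hσM : ∀ a ∈ M, (fun k => σ k a) ∈ finiteFunctions K (Subalgebra.toSubmodule M))
    (hσx : ∀ i, (fun k => σ k (x i)) ∈ finiteFunctions K (fil M x 1)) {n : ℕ} {a : W}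
    (ha : a ∈ fil M x n) : (fun k => σ k a) ∈ finiteFunctions K (fil M x n) := by
  let T : W →ₗ[ℂ] (K → W) := LinearMap.pi fun k => (σ k).toLinearMap
  suffices h : fil M x n ≤ (finiteFunctions K (fil M x n)).comap T from h ha
  clear ha
  induction n with
  | zero => exact hσM
  | succ n ih =>
    refine fil_succ_le (fun a ha => finiteFunctions_mono (fil_le_succ n) (ih ha)) fun i a ha => ?_
    have := mul_mem_finiteFunctions (U'' := fil M x (n + 1))
      (fun a ha b hb => by rw [add_comm]; exact mul_mem_fil hM ha hb) (hσx i) (ih ha)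
    have e : T (x i * a) = (fun k => σ k (x i)) * T a := by
      funext k
      simp [T]
    rwa [Submodule.mem_comap, e]

end Filtration

end InvDiffOp
end

noncomputable section

namespace InvDiffOp

open MeasureTheory

/-! ### The associated graded module and its Noetherian property -/

section AssociatedGraded

variable {W : Type*} [Ring W] [Algebra ℂ W] (M : Subalgebra ℂ W) {ι : Type*} (x : ι → W)

/-- The Rees module of the filtration `fil M x`. -/
def rees : Submodule ℂ (Polynomial W) where
  carrier := {p | ∀ n, p.coeff n ∈ fil M x n}
  zero_mem' n := by simp
  add_mem' hp hq n := by simpa using add_mem (hp n) (hq n)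
  smul_mem' c p hp n := by simpa using Submodule.smul_mem _ c (hp n)

/-- The elements of the Rees module that vanish in the associated graded module. -/
def reesPred : Submodule ℂ (rees M x) where
  carrier := {p | ∀ n, p.1.coeff n ∈ filPred M x n}
  zero_mem' n := by simp
  add_mem' hp hq n := by simpa using add_mem (hp n) (hq n)
  smul_mem' c p hp n := by simpa using Submodule.smul_mem _ c (hp n)

/-- The associated graded module of the filtration `fil M x`. -/
abbrev Gr : Type _ := rees M x ⧸ reesPred M x

/-- Multiplication by `x i` as an operator of degree one on the Rees module. -/
def reesMul (i : ι) : rees M x →ₗ[ℂ] rees M x :=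
  (LinearMap.mulLeft ℂ (Polynomial.C (x i) * Polynomial.X)).restrict (by
    intro p hp n
    cases n with
    | zero => simp
    | succ n =>
      rw [LinearMap.mulLeft_apply, mul_assoc, Polynomial.coeff_C_mul, Polynomial.coeff_X_mul]
      exact mul_mem_fil_succ i (hp n))

variable {M x}

lemma coeff_reesMul_zero (i : ι) (p : rees M x) : (reesMul M x i p).1.coeff 0 = 0 := by
  change (Polynomial.C (x i) * Polynomial.X * p.1).coeff 0 = 0
  simp [mul_assoc]

lemma coeff_reesMul_succ (i : ι) (p : rees M x) (n : ℕ) :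
    (reesMul M x i p).1.coeff (n + 1) = x i * p.1.coeff n := by
  change (Polynomial.C (x i) * Polynomial.X * p.1).coeff (n + 1) = _
  rw [mul_assoc, Polynomial.coeff_C_mul, Polynomial.coeff_X_mul]

variable (M x) in
/-- Multiplication by `x i` on the associated graded module. -/
def grMul (i : ι) : Module.End ℂ (Gr M x) :=
  (reesPred M x).mapQ (reesPred M x) (reesMul M x i) (by
    intro p hp n
    cases n with
    | zero => rw [coeff_reesMul_zero]; exact zero_mem _
    | succ n => rw [coeff_reesMul_succ]; exact mul_mem_filPred i (hp n))

/-- The homogeneous element of degree `n` of the Rees module given by `a`. -/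
def reesMonomial (n : ℕ) : fil M x n →ₗ[ℂ] rees M x where
  toFun a := ⟨Polynomial.monomial n a.1, fun m => by
    rw [Polynomial.coeff_monomial]
    split_ifs with h
    · exact h ▸ a.2
    · exact zero_mem _⟩
  map_add' a b := by ext1; simp
  map_smul' c a := by exact Subtype.ext (Polynomial.smul_monomial c n a.1).symm

/-- The class of `a` in degree `n` of the associated graded module. -/
def symbol (n : ℕ) : fil M x n →ₗ[ℂ] Gr M x := (reesPred M x).mkQ ∘ₗ reesMonomial n

lemma symbol_succ_of_mem {n : ℕ} {a : W} (ha : a ∈ fil M x n) :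
    symbol (n + 1) ⟨a, fil_le_succ n ha⟩ = 0 := by
  refine (Submodule.Quotient.mk_eq_zero _).2 fun m => ?_
  change (Polynomial.monomial (n + 1) a).coeff m ∈ _
  rw [Polynomial.coeff_monomial]
  split_ifs with h
  · subst h; exact ha
  · exact zero_mem _

lemma grMul_symbol (i : ι) (n : ℕ) (a : fil M x n) :
    grMul M x i (symbol n a) = symbol (n + 1) ⟨x i * a, mul_mem_fil_succ i a.2⟩ := by
  refine congrArg (reesPred M x).mkQ (Subtype.ext ?_)
  change Polynomial.C (x i) * Polynomial.X * Polynomial.monomial n a.1 = _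
  rw [mul_assoc, Polynomial.X_mul_monomial, Polynomial.C_mul_monomial]
  rfl

lemma gr_induction {p : Gr M x → Prop} (h : ∀ n a, p (symbol n a))
    (hadd : ∀ a b, p a → p b → p (a + b)) (q : Gr M x) : p q := by
  induction q using Submodule.Quotient.induction_on with
  | H q =>
    have hq : q = ∑ n ∈ q.1.support, reesMonomial n ⟨q.1.coeff n, q.2 n⟩ := by
      ext1
      rw [AddSubmonoidClass.coe_finsetSum]
      exact q.1.as_sum_support
    change p ((reesPred M x).mkQ q)
    rw [hq, map_sum]
    refine Finset.sum_induction _ p (fun a b => hadd a b) ?_ fun n _ => h n _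
    simpa using h 0 0

/-- The commutator of `x i` and `x j` raises the degree by at most one, so it dies in degree `n + 2`
of the graded module. -/
lemma grMul_commute (hM : ∀ i, ∀ a ∈ M, Commute (x i) a)
    (hx : ∀ i j, x i * x j - x j * x i ∈ fil M x 1) (i j : ι) :
    Commute (grMul M x i) (grMul M x j) := by
  refine LinearMap.ext fun q => ?_
  induction q using gr_induction with
  | hadd a b ha hb => rw [map_add, map_add, ha, hb]
  | h n a =>
    rw [Module.End.mul_apply, Module.End.mul_apply, grMul_symbol, grMul_symbol, grMul_symbol,
      grMul_symbol, ← sub_eq_zero, ← map_sub]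
    have : (x i * x j - x j * x i) * a.1 ∈ fil M x (n + 1) := by
      rw [add_comm]; exact mul_mem_fil hM (hx i j) a.2
    rw [← symbol_succ_of_mem this]
    congr 1
    ext1
    simp [sub_mul, mul_assoc]

variable (M x) in
/-- The algebra generated by the multiplications by the `x i`. -/
abbrev grAlg : Subalgebra ℂ (Module.End ℂ (Gr M x)) := Algebra.adjoin ℂ (Set.range (grMul M x))

lemma grAlg_smul_mem {P : Submodule ℂ (Gr M x)} (hP : ∀ i, ∀ q ∈ P, grMul M x i q ∈ P)
    (r : grAlg M x) {q : Gr M x} (hq : q ∈ P) : r • q ∈ P := by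
  obtain ⟨r, hr⟩ := r
  change r q ∈ P
  induction hr using Algebra.adjoin_induction generalizing q with
  | mem r hr => obtain ⟨i, rfl⟩ := hr; exact hP i q hq
  | algebraMap c => exact P.smul_mem c hq
  | add r s _ _ hr hs => exact P.add_mem (hr hq) (hs hq)
  | mul r s _ _ hr hs => exact hr (hs hq)

/-- The algebra `grAlg M x` is commutative and of finite type, hence Noetherian, and the symbols of
a finite spanning set of `M` generate `Gr M x` over it. No basis theorem of Poincaré–Birkhoff–Witt
type is involved. -/
lemma isNoetherian_gr [Finite ι] [Module.Finite ℂ M] (hM : ∀ i, ∀ a ∈ M, Commute (x i) a)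
    (hx : ∀ i j, x i * x j - x j * x i ∈ fil M x 1) : IsNoetherian (grAlg M x) (Gr M x) := by
  have hcomm : IsMulCommutative (grAlg M x) := Algebra.isMulCommutative_adjoin ℂ (by
    rintro _ ⟨i, rfl⟩ _ ⟨j, rfl⟩
    exact grMul_commute hM hx i j)
  let _ : CommRing (grAlg M x) :=
    { (grAlg M x).toRing with mul_comm := fun a b => hcomm.is_comm.comm a b }
  have : Algebra.FiniteType ℂ (grAlg M x) :=
    (Subalgebra.fg_iff_finiteType _).1 (Subalgebra.fg_def.2 ⟨_, Set.finite_range _, rfl⟩)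
  have : IsNoetherianRing (grAlg M x) := Algebra.FiniteType.isNoetherianRing ℂ _
  have : Module.Finite (grAlg M x) (Gr M x) := by
    obtain ⟨s, hs⟩ := (inferInstanceAs (Module.Finite ℂ M) : Module.Finite ℂ (fil M x 0)).fg_top
    classical
    refine ⟨⟨s.image (symbol 0), eq_top_iff.2 fun q _ => ?_⟩⟩
    induction q using gr_induction with
    | hadd a b ha hb => exact add_mem (ha trivial) (hb trivial)
    | h n a =>
      set P := Submodule.span (grAlg M x) (s.image (symbol 0) : Set (Gr M x)) with hP
      obtain ⟨a, ha⟩ := a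
      have h0 : ∀ a, symbol 0 a ∈ P := by
        intro a
        have ha : a ∈ Submodule.span ℂ (s : Set (fil M x 0)) := hs ▸ Submodule.mem_top
        induction ha using Submodule.span_induction with
        | mem a ha => exact Submodule.subset_span (by simpa using ⟨a, a.2, ha, rfl⟩)
        | zero => rw [map_zero]; exact zero_mem _
        | add a b _ _ ha hb => rw [map_add]; exact add_mem ha hb
        | smul c a _ ha =>
          rw [map_smul, ← algebraMap_smul (grAlg M x)]
          exact P.smul_mem _ ha
      have key : ∀ n a (ha : a ∈ fil M x n), symbol n ⟨a, ha⟩ ∈ P := by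
        intro n
        induction n with
        | zero => exact fun a ha => h0 ⟨a, ha⟩
        | succ n ih =>
          intro a ha
          -- Elements of `fil M x n` have zero symbol in degree `n + 1`; the symbol of `x i * b` is
          -- `grMul M x i` applied to that of `b`.
          have : fil M x (n + 1) ≤ ((P.restrictScalars ℂ).comap (symbol (n + 1))).map
              (fil M x (n + 1)).subtype := by
            refine fil_succ_le (fun b hb => ⟨⟨b, fil_le_succ n hb⟩, ?_, rfl⟩)
              fun i b hb => ⟨⟨_, mul_mem_fil_succ i hb⟩, ?_, rfl⟩
            · change symbol (n + 1) _ ∈ P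
              rw [symbol_succ_of_mem hb]
              exact zero_mem _
            · change symbol (n + 1) _ ∈ P
              rw [← grMul_symbol i n ⟨b, hb⟩]
              exact P.smul_mem (⟨_, Algebra.subset_adjoin ⟨i, rfl⟩⟩ : grAlg M x) (ih b hb)
          obtain ⟨⟨b, hb⟩, hb', rfl⟩ := this ha
          exact hb'
      exact key n a ha
  exact isNoetherian_of_isNoetherianRing_of_finite (grAlg M x) (Gr M x)

variable (M x) in
/-- Degree `n` of the graded left ideal generated by elements `D` of degree `d`, for
`(d, D) ∈ s`. -/
def leftIdeal (s : Set (ℕ × W)) (n : ℕ) : Submodule ℂ W :=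
  Submodule.span ℂ {b | ∃ p ∈ s, ∃ m, m + p.1 = n ∧ ∃ z ∈ fil M x m, b = z * p.2}

lemma mul_mem_leftIdeal (s : Set (ℕ × W)) (i : ι) {n : ℕ} {a : W} (ha : a ∈ leftIdeal M x s n) :
    x i * a ∈ leftIdeal M x s (n + 1) := by
  refine Submodule.span_le (p := (leftIdeal M x s (n + 1)).comap (LinearMap.mulLeft ℂ (x i))).2
    ?_ ha
  rintro _ ⟨p, hp, m, rfl, z, hz, rfl⟩
  refine Submodule.subset_span ⟨p, hp, m + 1, by omega, _, mul_mem_fil_succ i hz, ?_⟩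
  simp [mul_assoc]

/-- A family of homogeneous elements of the associated graded module generates the same left ideal
as a finite subfamily. -/
lemma exists_finite_leftIdeal [Finite ι] [Module.Finite ℂ M]
    (hM : ∀ i, ∀ a ∈ M, Commute (x i) a) (hx : ∀ i j, x i * x j - x j * x i ∈ fil M x 1)
    (S : Set (ℕ × W)) (hS : ∀ p ∈ S, p.2 ∈ fil M x p.1) :
    ∃ s ⊆ S, s.Finite ∧ ∀ p ∈ S, ∃ j ∈ leftIdeal M x s p.1, p.2 - j ∈ filPred M x p.1 := by
  have := isNoetherian_gr hM hx
  let f : S → Gr M x := fun p => symbol p.1.1 ⟨p.1.2, hS _ p.2⟩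
  obtain ⟨t, ht, hts⟩ := (Submodule.fg_span_iff_fg_span_finset_subset (R := grAlg M x)
    (Set.range f)).1 (IsNoetherian.noetherian _)
  choose g hg using fun y : t => ht y.2
  refine ⟨Set.range fun y => (g y).1, ?_, Set.finite_range _, fun p hp => ?_⟩
  · rintro _ ⟨y, rfl⟩
    exact (g y).2
  set s : Set (ℕ × W) := Set.range fun y => (g y).1
  -- The image of `R` in `Gr M x` is stable under `grAlg M x` and contains the chosen generators, so
  -- it contains every symbol from `S`.
  let R : Submodule ℂ (rees M x) :=
    { carrier := {p | ∀ n, p.1.coeff n ∈ leftIdeal M x s n}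
      zero_mem' := fun n => by simp
      add_mem' := fun hp hq n => by simpa using add_mem (hp n) (hq n)
      smul_mem' := fun c p hp n => by simpa using Submodule.smul_mem _ c (hp n) }
  have hR : ∀ i, ∀ q ∈ R.map (reesPred M x).mkQ, grMul M x i q ∈ R.map (reesPred M x).mkQ := by
    rintro i _ ⟨q, hq, rfl⟩
    refine ⟨reesMul M x i q, fun n => ?_, rfl⟩
    cases n with
    | zero => rw [coeff_reesMul_zero]; exact zero_mem _
    | succ n => rw [coeff_reesMul_succ]; exact mul_mem_leftIdeal s i (hq n)
  have hspan : ∀ q ∈ Submodule.span (grAlg M x) (t : Set (Gr M x)),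
      q ∈ R.map (reesPred M x).mkQ := by
    intro q hq
    induction hq using Submodule.span_induction with
    | mem y hy =>
      refine ⟨reesMonomial _ ⟨_, hS _ (g ⟨y, hy⟩).2⟩, fun n => ?_, hg ⟨y, hy⟩⟩
      change (Polynomial.monomial (g ⟨y, hy⟩).1.1 (g ⟨y, hy⟩).1.2).coeff n ∈ _
      rw [Polynomial.coeff_monomial]
      split_ifs with h
      · refine Submodule.subset_span ⟨(g ⟨y, hy⟩).1, ⟨_, rfl⟩, 0, by omega, 1, M.one_mem, ?_⟩
        rw [one_mul]
      · exact zero_mem _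
    | zero => exact zero_mem _
    | add a b _ _ ha hb => exact add_mem ha hb
    | smul r a _ ha => exact grAlg_smul_mem hR r ha
  obtain ⟨q, hq, hqp⟩ := hspan (f ⟨p, hp⟩) (hts ▸ Submodule.subset_span ⟨_, rfl⟩)
  refine ⟨q.1.coeff p.1, hq p.1, ?_⟩
  have := (Submodule.Quotient.eq _).1 hqp.symm p.1
  change (Polynomial.monomial p.1 p.2 - q.1).coeff p.1 ∈ _ at this
  simpa using this

end AssociatedGraded

/-! ### Hilbert's finiteness theorem for invariants -/

section Invariants

variable {W : Type*} [Ring W] [Algebra ℂ W] {M : Subalgebra ℂ W} {ι : Type*} {x : ι → W}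
variable {K : Type*} [Group K] [TopologicalSpace K]

variable (M x) in
/-- The invariants of the union of the filtration `fil M x`. -/
def filInvariants (σ : K →* (W →ₐ[ℂ] W)) (hM : ∀ i, ∀ a ∈ M, Commute (x i) a) :
    Subalgebra ℂ W where
  carrier := {a | (∃ n, a ∈ fil M x n) ∧ ∀ k, σ k a = a}
  mul_mem' := by
    rintro a b ⟨⟨m, ha⟩, ha'⟩ ⟨⟨n, hb⟩, hb'⟩
    exact ⟨⟨m + n, mul_mem_fil hM ha hb⟩, fun k => by rw [map_mul, ha', hb']⟩
  add_mem' := by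
    rintro a b ⟨⟨m, ha⟩, ha'⟩ ⟨⟨n, hb⟩, hb'⟩
    exact ⟨⟨max m n, add_mem (fil_mono (le_max_left m n) ha) (fil_mono (le_max_right m n) hb)⟩,
      fun k => by rw [map_add, ha', hb']⟩
  algebraMap_mem' c := ⟨⟨0, M.algebraMap_mem c⟩, fun k => AlgHom.commutes _ c⟩

/-- Hilbert's finiteness theorem for the invariants of a compact group in a filtered algebra whose
associated graded algebra is generated by commuting elements over a finite-dimensional algebra. -/
theorem fg_filInvariants [IsTopologicalGroup K] [CompactSpace K] [Finite ι] [Module.Finite ℂ M]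
    (σ : K →* (W →ₐ[ℂ] W)) (hM : ∀ i, ∀ a ∈ M, Commute (x i) a)
    (hx : ∀ i j, x i * x j - x j * x i ∈ fil M x 1)
    (hσM : ∀ a ∈ M, (fun k => σ k a) ∈ finiteFunctions K (Subalgebra.toSubmodule M))
    (hσx : ∀ i, (fun k => σ k (x i)) ∈ finiteFunctions K (fil M x 1)) :
    (filInvariants M x σ hM).FG := by
  borelize K
  let μ : Measure K := Measure.haarMeasure ⊤
  have : IsProbabilityMeasure μ := ⟨Measure.haarMeasure_self⟩
  have average : ∀ n, ∀ a ∈ fil M x n, ∃ u ∈ fil M x n, IsAverage μ (fun k => σ k a) u :=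
    fun n a ha => exists_isAverage (mem_finiteFunctions_fil hM hσM hσx ha)
  -- Positive degree of the generators forces their coefficients into degrees strictly below that of
  -- the product, as the induction requires.
  let S : Set (ℕ × W) := {p | 0 < p.1 ∧ p.2 ∈ fil M x p.1 ∧ ∀ k, σ k p.2 = p.2}
  obtain ⟨s, hsS, hs, hgen⟩ := exists_finite_leftIdeal hM hx S fun p hp => hp.2.1
  -- The invariants of degree zero form a finite-dimensional space, and a spanning set of it is
  -- adjoined separately.
  let M' : Submodule ℂ M :=
    { carrier := {a | ∀ k, σ k a = a}
      zero_mem' := fun k => by simp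
      add_mem' := fun {a b} ha hb k => by simp [ha k, hb k]
      smul_mem' := fun c a ha k => by simp [ha k] }
  obtain ⟨t, ht⟩ := IsNoetherian.noetherian M'
  refine Subalgebra.fg_def.2 ⟨Subtype.val '' (t : Set M) ∪ Prod.snd '' s,
    (t.finite_toSet.image _).union (hs.image _), le_antisymm (Algebra.adjoin_le ?_) ?_⟩
  · rintro _ (⟨a, ha, rfl⟩ | ⟨p, hp, rfl⟩)
    · exact ⟨⟨0, a.2⟩, show a ∈ M' from ht ▸ Submodule.subset_span ha⟩
    · exact ⟨⟨p.1, (hsS hp).2.1⟩, (hsS hp).2.2⟩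
  set C := Algebra.adjoin ℂ (Subtype.val '' (t : Set M) ∪ Prod.snd '' s)
  suffices h : ∀ n, ∀ a ∈ fil M x n, (∀ k, σ k a = a) → a ∈ C by
    rintro a ⟨⟨n, ha⟩, ha'⟩
    exact h n a ha ha'
  intro n
  induction n using Nat.strong_induction_on with
  | _ n ih =>
  intro a ha ha'
  rcases n with _ | n
  · have : (⟨a, ha⟩ : M) ∈ M' := ha'
    rw [← ht] at this
    have h := Submodule.span_le (p := (Subalgebra.toSubmodule C).comap M.val.toLinearMap).2
      (fun b hb => Algebra.subset_adjoin (Or.inl ⟨b, hb, rfl⟩)) this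
    exact h
  obtain ⟨j, hj, haj⟩ := hgen (n + 1, a) ⟨n.succ_pos, ha, ha'⟩
  -- In a term `z * p.2` the factor `p.2` is fixed, so averaging affects only `z`. The average of
  -- `z` is an invariant of smaller degree, hence in `C` by induction.
  have hjC : ∃ u ∈ C, IsAverage μ (fun k => σ k j) u := by
    refine Submodule.span_induction ?_ ⟨0, C.zero_mem, by simpa using! IsAverage.zero⟩ ?_ ?_ hj
    · rintro _ ⟨p, hp, m, hm, z, hz, rfl⟩
      obtain ⟨u, hu, hu'⟩ := average m z hz
      refine ⟨u * p.2, C.mul_mem (ih m ?_ u hu fun k => hu'.apply_eq k)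
        (Algebra.subset_adjoin (Or.inr ⟨p, hp, rfl⟩)), ?_⟩
      · have := (hsS hp).1
        change m + p.1 = n + 1 at hm
        omega
      · have := hu'.map (LinearMap.mulRight ℂ p.2)
        simpa [(hsS hp).2.2] using! this
    · rintro b c _ _ ⟨u, hu, hu'⟩ ⟨v, hv, hv'⟩
      exact ⟨u + v, C.add_mem hu hv, by simpa using! hu'.add hv'⟩
    · rintro r b _ ⟨u, hu, hu'⟩
      exact ⟨r • u, C.smul_mem hu r, by simpa using! hu'.smul r⟩
  obtain ⟨u, hu, hu'⟩ := hjC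
  -- The remainder lies in `filPred M x (n + 1)`, which is `fil M x n`, so its average is covered by
  -- the induction as well.
  obtain ⟨v, hv, hv'⟩ := average n (a - j) haj
  have hav : a = u + v := by
    refine (IsAverage.const (μ := μ) a).unique ?_
    have := hu'.add hv'
    convert this using 1
    funext k
    simp [ha']
  rw [hav]
  exact C.add_mem hu (ih n n.lt_succ_self v hv fun k => hv'.apply_eq k)

/-- Composing a functional on `V` with `T` and evaluation of `ρ` at `f` gives a functional on `W`,
to which the weak integral applies. A value constant along the orbit survives because `μ` has mass
one. -/
lemma exists_invariant_average [IsTopologicalGroup K] [CompactSpace K]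
    {σ : K →* (W →ₐ[ℂ] W)} (hM : ∀ i, ∀ a ∈ M, Commute (x i) a)
    (hσM : ∀ a ∈ M, (fun k => σ k a) ∈ finiteFunctions K (Subalgebra.toSubmodule M))
    (hσx : ∀ i, (fun k => σ k (x i)) ∈ finiteFunctions K (fil M x 1)) {F V : Type*}
    [AddCommGroup F] [Module ℂ F] [AddCommGroup V] [Module ℂ V] (ρ : W →ₐ[ℂ] Module.End ℂ F)
    (T : F →ₗ[ℂ] V) {n : ℕ} {a : W} (ha : a ∈ fil M x n) :
    ∃ u ∈ fil M x n, (∀ k, σ k u = u) ∧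
      ∀ (f : F) (v : V), (∀ k, T (ρ (σ k a) f) = v) → T (ρ u f) = v := by
  borelize K
  let μ : Measure K := Measure.haarMeasure ⊤
  have : IsProbabilityMeasure μ := ⟨Measure.haarMeasure_self⟩
  obtain ⟨u, hu, h⟩ := exists_isAverage (μ := μ) (mem_finiteFunctions_fil hM hσM hσx ha)
  refine ⟨u, hu, fun k => h.apply_eq k, fun f v hv => ?_⟩
  rw [← sub_eq_zero, ← Module.forall_dual_apply_eq_zero_iff ℂ]
  intro ℓ
  have h2 := (h (ℓ ∘ₗ T ∘ₗ LinearMap.applyₗ f ∘ₗ ρ.toLinearMap)).2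
  simp only [LinearMap.comp_apply, AlgHom.toLinearMap_apply, LinearMap.applyₗ_apply_apply, hv,
    integral_const, probReal_univ, one_smul] at h2
  rw [map_sub, h2, sub_self]

end Invariants

end InvDiffOp
end

noncomputable section

namespace InvDiffOp

open MeasureTheory

/-! ### Finite-dimensionality of irreducible unitary representations -/

section FiniteDimensional

variable {G : Type*} [Group G] [TopologicalSpace G] [IsTopologicalGroup G] {K : Subgroup G}
variable {V : Type*} [NormedAddCommGroup V] [InnerProductSpace ℂ V] [CompleteSpace V]

open InnerProductSpace in
/-- An irreducible unitary representation of a compact group is finite-dimensional. -/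
theorem IsIrreducibleUnitaryRep.finiteDimensional [CompactSpace K] {τ : K →* (V ≃ₗᵢ[ℂ] V)}
    (hτ : IsIrreducibleUnitaryRep τ) : FiniteDimensional ℂ V := by
  let _ : MeasurableSpace K := borel K
  have : BorelSpace K := ⟨rfl⟩
  let μ : Measure K := Measure.haarMeasure ⊤
  have : IsProbabilityMeasure μ := ⟨Measure.haarMeasure_self⟩
  have := hτ.nontrivial
  obtain ⟨v, hv⟩ := exists_ne (0 : V)
  -- The average `T` of the rank-one operators attached to the orbit of `v` is compact,
  -- self-adjoint, nonzero and commutes with `τ`. An eigenspace for a nonzero eigenvalue is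
  -- finite-dimensional and invariant, so it is all of `V`.
  let P : K → V →L[ℂ] V := fun k => rankOne ℂ (τ k v) (τ k v)
  have hPc : Continuous P :=
    (ContinuousLinearMap.smulRightL ℂ V V).continuous₂.comp
      (((innerSL ℂ).continuous.comp (hτ.continuous_apply v)).prodMk (hτ.continuous_apply v))
  have hP : Integrable P μ :=
    hPc.integrable_of_hasCompactSupport (HasCompactSupport.of_compactSpace _)
  let T : V →L[ℂ] V := ∫ k, P k ∂μ
  have hT_apply : ∀ w, T w = ∫ k, P k w ∂μ := fun w => ContinuousLinearMap.integral_apply hP w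
  have hTc : IsCompactOperator T := by
    have hclosed : IsClosed {f : V →L[ℂ] V | IsCompactOperator f} :=
      isClosed_setOfPred_isCompactOperator
    -- Compact operators form a closed convex set, which contains the average of any integrable
    -- family of its elements.
    refine Convex.integral_mem (s := {f : V →L[ℂ] V | IsCompactOperator f}) ?_ hclosed
      (.of_forall fun k => ?_) hP
    · exact ((compactOperator (RingHom.id ℂ) V V).restrictScalars ℝ).convex
    · exact (isCompactOperator_of_locallyCompactSpace_dom (innerSL ℂ (τ k v))).clm_comp
        (.toSpanSingleton ℂ (τ k v))
  have hTs : T.IsSymmetric := by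
    intro a b
    change inner ℂ (T a) b = inner ℂ a (T b)
    have hi : ∀ w, Integrable (fun k => P k w) μ := fun w => hP.apply_continuousLinearMap w
    rw [hT_apply, hT_apply, ← integral_inner (hi b) a, ← inner_conj_symm,
      ← integral_inner (hi a) b, ← integral_conj]
    refine integral_congr_ae (.of_forall fun k => ?_)
    change (starRingEnd ℂ) (inner ℂ b (P k a)) = _
    rw [inner_conj_symm]
    exact isSymmetric_rankOne_self (τ k v) a b
  have hTτ : ∀ h w, T (τ h w) = τ h (T w) := by
    intro h w
    have e : ∀ k, P (h * k) (τ h w) = τ h (P k w) := fun k => by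
      simp [P, LinearIsometryEquiv.inner_map_map]
    rw [hT_apply, ← integral_mul_left_eq_self _ h]
    simp only [e]
    rw [hT_apply]
    exact (τ h).toContinuousLinearEquiv.integral_comp_comm (fun k => P k w)
  have hT0 : T ≠ 0 := by
    intro h0
    -- If `T = 0`, then `⟨v, T v⟩ = ∫ |⟨τ(k) v, v⟩|²` vanishes, although the integrand is
    -- continuous, nonnegative and positive at `k = 1`.
    have h1 : ∫ k, ‖(inner ℂ (τ k v) v : ℂ)‖ ^ 2 ∂μ = 0 := by
      have h2 : inner ℂ v (T v) = 0 := by simp [h0]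
      rw [hT_apply, ← integral_inner (hP.apply_continuousLinearMap v)] at h2
      have e : ∀ k, inner ℂ v (P k v) = ((‖(inner ℂ (τ k v) v : ℂ)‖ ^ 2 : ℝ) : ℂ) := fun k => by
        rw [rankOne_apply, inner_smul_right, ← inner_conj_symm v (τ k v), Complex.mul_conj']
        simp
      simp only [e] at h2
      rw [integral_complex_ofReal] at h2
      exact_mod_cast h2
    refine (Continuous.integral_pos_of_hasCompactSupport_nonneg_nonzero (μ := μ) (x := (1 : K))
      ?_ (HasCompactSupport.of_compactSpace _) (fun k => by positivity) ?_).ne' h1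
    · exact (((hτ.continuous_apply v).inner continuous_const).norm).pow 2
    · simpa using hv
  obtain ⟨c, hc, hc0⟩ : ∃ c, Module.End.HasEigenvalue (T : Module.End ℂ V) c ∧ c ≠ 0 := by
    by_contra! h
    exact hT0 ((ContinuousLinearMap.eq_zero_of_forall_hasEigenvalue_eq_zero hTc hTs).1 h)
  have hfin := ContinuousLinearMap.finite_dimensional_eigenspace hTc c hc0
  have hinv : ∀ k, ∀ w ∈ Module.End.eigenspace T.toLinearMap c,
      τ k w ∈ Module.End.eigenspace T.toLinearMap c := by
    intro k w hw
    rw [Module.End.mem_eigenspace_iff] at hw ⊢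
    change T w = c • w at hw
    change T (τ k w) = c • τ k w
    rw [hTτ, hw, map_smul]
  rcases hτ.eq_bot_or_eq_top _ (Submodule.closed_of_finiteDimensional _) hinv with h | h
  · exact absurd h hc
  · rw [h] at hfin
    exact Module.Finite.equiv Submodule.topEquiv

end FiniteDimensional

end InvDiffOp
end

noncomputable section

namespace InvDiffOp

open Topology

/-! ### Vanishing of jets in a normed space -/

section Jets

variable {E : Type*} [NormedAddCommGroup E] [NormedSpace ℝ E]
variable {F : Type*} [NormedAddCommGroup F] [NormedSpace ℝ F]
variable {F' : Type*} [NormedAddCommGroup F'] [NormedSpace ℝ F']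
variable {F'' : Type*} [NormedAddCommGroup F''] [NormedSpace ℝ F'']

/-- All derivatives of `f` of order at most `n` vanish at `x`. -/
def JetZero (n : ℕ) (f : E → F) (x : E) : Prop := ∀ j ≤ n, iteratedFDeriv ℝ j f x = 0

lemma JetZero.congr {n : ℕ} {f g : E → F} {x : E} (h : JetZero n f x) (hfg : f =ᶠ[𝓝 x] g) :
    JetZero n g x := fun j hj => by
  rw [← (hfg.iteratedFDeriv ℝ j).eq_of_nhds, h j hj]

lemma jetZero_zero_iff {f : E → F} {x : E} : JetZero 0 f x ↔ f x = 0 := by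
  refine ⟨fun h => ?_, fun h j hj => ?_⟩
  · simpa [← norm_eq_zero] using h 0 le_rfl
  · obtain rfl : j = 0 := by omega
    rw [← norm_eq_zero, norm_iteratedFDeriv_zero, h, norm_zero]

lemma jetZero_succ_iff {n : ℕ} {f : E → F} {x : E} :
    JetZero (n + 1) f x ↔ f x = 0 ∧ JetZero n (fderiv ℝ f) x := by
  refine ⟨fun h => ⟨jetZero_zero_iff.1 fun j hj => h j (by omega), fun j hj => ?_⟩,
    fun h j hj => ?_⟩
  · rw [← norm_eq_zero, norm_iteratedFDeriv_fderiv, h _ (by omega), norm_zero]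
  · cases j with
    | zero => exact jetZero_zero_iff.2 h.1 0 le_rfl
    | succ j => rw [← norm_eq_zero, ← norm_iteratedFDeriv_fderiv, h.2 j (by omega), norm_zero]

/-- Every term of the Leibniz bound contains a derivative of `f` of order at most `n`. -/
lemma JetZero.bilinear {n : ℕ} {f : E → F} {g : E → F'} {x : E} (h : JetZero n f x)
    (B : F →L[ℝ] F' →L[ℝ] F'') (hf : ContDiffAt ℝ ∞ f x) (hg : ContDiffAt ℝ ∞ g x) :
    JetZero n (fun y => B (f y) (g y)) x := by
  intro j hj
  obtain ⟨u, hu, hfu⟩ := hf.contDiffOn (m := (n : ℕ∞ω)) (by exact_mod_cast le_top) (by simp)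
  obtain ⟨v, hv, hgv⟩ := hg.contDiffOn (m := (n : ℕ∞ω)) (by exact_mod_cast le_top) (by simp)
  obtain ⟨s, hs, hso, hxs⟩ := mem_nhds_iff.1 (Filter.inter_mem hu hv)
  have key := B.norm_iteratedFDerivWithin_le_of_bilinear
    (hfu.mono (hs.trans Set.inter_subset_left)) (hgv.mono (hs.trans Set.inter_subset_right))
    hso.uniqueDiffOn hxs (n := j) (by exact_mod_cast hj)
  rw [iteratedFDerivWithin_of_isOpen j hso hxs] at key
  rw [← norm_le_zero_iff]
  refine key.trans (le_of_eq ?_)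
  rw [Finset.sum_eq_zero, mul_zero]
  intro i hi
  rw [iteratedFDerivWithin_of_isOpen i hso hxs,
    h i (by have := Finset.mem_range.1 hi; omega)]
  simp

lemma JetZero.clm_comp {n : ℕ} {f : E → F} {x : E} (h : JetZero n f x) (L : F →L[ℝ] F')
    (hf : ContDiffAt ℝ ∞ f x) : JetZero n (fun y => L (f y)) x := by
  intro j hj
  have := L.iteratedFDeriv_comp_left hf (i := j) (by exact_mod_cast le_top)
  rw [h j hj] at this
  exact this.trans (by ext; simp)

lemma JetZero.sum {n : ℕ} {ι : Type*} {s : Finset ι} {f : ι → E → F} {x : E}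
    (h : ∀ i ∈ s, JetZero n (f i) x) (hf : ∀ i ∈ s, ContDiffAt ℝ ∞ (f i) x) :
    JetZero n (fun y => ∑ i ∈ s, f i y) x := by
  intro j hj
  rw [iteratedFDeriv_fun_sum_apply fun i hi => (hf i hi).of_le (by exact_mod_cast le_top)]
  exact Finset.sum_eq_zero fun i hi => h i hi j hj

end Jets

/-! ### Left-invariant vector fields in charts -/

section InvariantFields

section

variable {E : Type*} [NormedAddCommGroup E]
variable {G : Type*} [TopologicalSpace G] [ChartedSpace E G] [Group G]

variable (E G) in
/-- The coordinates of the identity in the chart there. -/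
def oneCoord : E := chartAt E (1 : G) 1

lemma oneCoord_mem_target : oneCoord E G ∈ (chartAt E (1 : G)).target := mem_chart_target E (1 : G)

@[simp] lemma chart_symm_oneCoord : (chartAt E (1 : G)).symm (oneCoord E G) = 1 :=
  (chartAt E (1 : G)).left_inv (mem_chart_source E 1)

end

variable {E : Type*} [NormedAddCommGroup E] [NormedSpace ℝ E]
variable {G : Type*} [TopologicalSpace G] [ChartedSpace E G] [Group G]
variable {V : Type*} [NormedAddCommGroup V] [NormedSpace ℝ V]

variable (E) in
/-- The derivative of `f` at `g` along the left-invariant vector field with value `v` at the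
identity. -/
def lieDeriv (v : E) (f : G → V) (g : G) : V :=
  fderiv ℝ (fun y => f (g * (chartAt E (1 : G)).symm y)) (oneCoord E G) v

lemma lieDeriv_comp_mul_left (v : E) (f : G → V) (g h : G) :
    lieDeriv E v (fun a => f (h * a)) g = lieDeriv E v f (h * g) := by
  simp only [lieDeriv, mul_assoc]

/-- Left translation by `g` in the charts at the identity and at `g`, differentiated at the
identity, as a function of the coordinates of the translating element. -/
def translationDeriv (g : G) (y : E) : E →L[ℝ] E :=
  fderiv ℝ (fun z => chartAt E g ((chartAt E g).symm y * (chartAt E (1 : G)).symm z))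
    (oneCoord E G)

lemma translationDeriv_one_oneCoord :
    translationDeriv (1 : G) (oneCoord E G) = ContinuousLinearMap.id ℝ E := by
  have : (fun z => chartAt E (1 : G) ((chartAt E (1 : G)).symm (oneCoord E G) *
      (chartAt E (1 : G)).symm z)) =ᶠ[𝓝 (oneCoord E G)] id := by
    filter_upwards [(chartAt E (1 : G)).open_target.mem_nhds oneCoord_mem_target] with z hz
    simp [(chartAt E (1 : G)).right_inv hz]
  rw [translationDeriv, this.fderiv_eq, fderiv_id]

variable [LieGroup 𝓘(ℝ, E) ∞ G]

lemma contMDiffAt_chart_symm_of_mem {g : G} {y : E} (hy : y ∈ (chartAt E g).target) :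
    ContMDiffAt 𝓘(ℝ, E) 𝓘(ℝ, E) ∞ (chartAt E g).symm y :=
  contMDiffOn_chart_symm.contMDiffAt ((chartAt E g).open_target.mem_nhds hy)

lemma contMDiffAt_chart_of_mem {g h : G} (hh : h ∈ (chartAt E g).source) :
    ContMDiffAt 𝓘(ℝ, E) 𝓘(ℝ, E) ∞ (chartAt E g) h :=
  contMDiffOn_chart.contMDiffAt ((chartAt E g).open_source.mem_nhds hh)

lemma contMDiffAt_chart_symm_oneCoord :
    ContMDiffAt 𝓘(ℝ, E) 𝓘(ℝ, E) ∞ (chartAt E (1 : G)).symm (oneCoord E G) :=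
  contMDiffAt_chart_symm_of_mem oneCoord_mem_target

lemma contDiffAt_translationDeriv (g : G) :
    ContDiffAt ℝ ∞ (translationDeriv (E := E) g) (chartAt E g g) := by
  refine ContDiffAt.fderiv (n := ∞)
    (f := fun y z => chartAt E g ((chartAt E g).symm y * (chartAt E (1 : G)).symm z))
    (g := fun _ => oneCoord E G) ?_ contDiffAt_const (by simp)
  rw [← contMDiffAt_iff_contDiffAt]
  have h1 : ContMDiffAt 𝓘(ℝ, E × E) 𝓘(ℝ, E) ∞ (fun p : E × E => (chartAt E g).symm p.1)
      (chartAt E g g, oneCoord E G) :=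
    ContMDiffAt.comp (I' := 𝓘(ℝ, E)) (chartAt E g g, oneCoord E G)
      (contMDiffAt_chart_symm_of_mem (mem_chart_target E g)) contDiff_fst.contMDiff.contMDiffAt
  have h2 : ContMDiffAt 𝓘(ℝ, E × E) 𝓘(ℝ, E) ∞ (fun p : E × E => (chartAt E (1 : G)).symm p.2)
      (chartAt E g g, oneCoord E G) :=
    ContMDiffAt.comp (I' := 𝓘(ℝ, E)) (chartAt E g g, oneCoord E G)
      contMDiffAt_chart_symm_oneCoord contDiff_snd.contMDiff.contMDiffAt
  refine ContMDiffAt.comp (I' := 𝓘(ℝ, E)) (g := chartAt E g)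
    (f := fun p : E × E => (chartAt E g).symm p.1 * (chartAt E (1 : G)).symm p.2)
    (chartAt E g g, oneCoord E G) ?_ (h1.mul h2)
  apply contMDiffAt_chart_of_mem
  simp

lemma contMDiffAt_mul_chart_symm (h : G) :
    ContMDiffAt 𝓘(ℝ, E) 𝓘(ℝ, E) ∞ (fun z => h * (chartAt E (1 : G)).symm z) (oneCoord E G) :=
  contMDiffAt_const.mul contMDiffAt_chart_symm_oneCoord

lemma contDiffAt_chart_mul_chart_symm {g h : G} (hh : h ∈ (chartAt E g).source) :
    ContDiffAt ℝ ∞ (fun z => chartAt E g (h * (chartAt E (1 : G)).symm z)) (oneCoord E G) := by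
  rw [← contMDiffAt_iff_contDiffAt]
  refine ContMDiffAt.comp (I' := 𝓘(ℝ, E)) (g := chartAt E g) (oneCoord E G) ?_
    (contMDiffAt_mul_chart_symm h)
  apply contMDiffAt_chart_of_mem
  simpa using hh

lemma contDiffAt_comp_chart_symm {f : G → V} (hf : ContMDiff 𝓘(ℝ, E) 𝓘(ℝ, V) ∞ f) (g : G) {y : E}
    (hy : y ∈ (chartAt E g).target) : ContDiffAt ℝ ∞ (f ∘ (chartAt E g).symm) y :=
  contMDiffAt_iff_contDiffAt.1
    (ContMDiffAt.comp (I' := 𝓘(ℝ, E)) y hf.contMDiffAt (contMDiffAt_chart_symm_of_mem hy))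

/-- The chain rule writes the field in the chart at `g` as a first-order operator, whose coefficient
`translationDeriv g y v` is smooth in `y` near the coordinates of `g`. -/
lemma lieDeriv_chart_symm {f : G → V} (hf : ContMDiff 𝓘(ℝ, E) 𝓘(ℝ, V) ∞ f) (g : G) (v : E) {y : E}
    (hy : y ∈ (chartAt E g).target) :
    lieDeriv E v f ((chartAt E g).symm y) =
      fderiv ℝ (f ∘ (chartAt E g).symm) y (translationDeriv g y v) := by
  have hs : (chartAt E g).symm y ∈ (chartAt E g).source := (chartAt E g).map_target hy
  set c : E → E := fun z => chartAt E g ((chartAt E g).symm y * (chartAt E (1 : G)).symm z) with hc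
  have hc0 : c (oneCoord E G) = y := by simp [hc, (chartAt E g).right_inv hy]
  have hev : (fun z => f ((chartAt E g).symm y * (chartAt E (1 : G)).symm z)) =ᶠ[𝓝 (oneCoord E G)]
      (f ∘ (chartAt E g).symm) ∘ c := by
    have hcont := (contMDiffAt_mul_chart_symm (E := E) ((chartAt E g).symm y)).continuousAt
    have : (chartAt E g).source ∈ 𝓝 ((chartAt E g).symm y *
        (chartAt E (1 : G)).symm (oneCoord E G)) :=
      (chartAt E g).open_source.mem_nhds (by simpa using hs)
    filter_upwards [hcont this] with z hz
    simp only [Function.comp_apply, hc]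
    rw [(chartAt E g).left_inv hz]
  have hd : DifferentiableAt ℝ c (oneCoord E G) :=
    (contDiffAt_chart_mul_chart_symm hs).differentiableAt (by simp)
  rw [lieDeriv, hev.fderiv_eq, fderiv_comp, hc0]
  · rfl
  · rw [hc0]
    exact (contDiffAt_comp_chart_symm hf g hy).differentiableAt (by simp)
  · exact hd

lemma lieDeriv_chart_symm_eventuallyEq {f : G → V} (hf : ContMDiff 𝓘(ℝ, E) 𝓘(ℝ, V) ∞ f) (g : G)
    (v : E) : lieDeriv E v f ∘ (chartAt E g).symm =ᶠ[𝓝 (chartAt E g g)]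
      fun y => fderiv ℝ (f ∘ (chartAt E g).symm) y (translationDeriv g y v) := by
  filter_upwards [(chartAt E g).open_target.mem_nhds (mem_chart_target E g)] with y hy
  exact lieDeriv_chart_symm hf g v hy

lemma contDiffAt_fderiv_comp_chart_symm {f : G → V} (hf : ContMDiff 𝓘(ℝ, E) 𝓘(ℝ, V) ∞ f) (g : G) :
    ContDiffAt ℝ ∞ (fderiv ℝ (f ∘ (chartAt E g).symm)) (chartAt E g g) :=
  (contDiffAt_comp_chart_symm hf g (mem_chart_target E g)).fderiv_right (by simp)

lemma contMDiff_lieDeriv {f : G → V} (hf : ContMDiff 𝓘(ℝ, E) 𝓘(ℝ, V) ∞ f) (v : E) :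
    ContMDiff 𝓘(ℝ, E) 𝓘(ℝ, V) ∞ (lieDeriv E v f) := by
  intro g
  have h1 : ContDiffAt ℝ ∞ (fun y => fderiv ℝ (f ∘ (chartAt E g).symm) y (translationDeriv g y v))
      (chartAt E g g) :=
    (contDiffAt_fderiv_comp_chart_symm hf g).clm_apply
      ((contDiffAt_translationDeriv g).clm_apply contDiffAt_const)
  have h2 := ContMDiffAt.comp (I' := 𝓘(ℝ, E)) g h1.contMDiffAt
    (contMDiffAt_chart_of_mem (mem_chart_source E g))
  refine h2.congr_of_eventuallyEq ?_
  filter_upwards [(chartAt E g).open_source.mem_nhds (mem_chart_source E g)] with h hh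
  rw [Function.comp_apply, ← lieDeriv_chart_symm hf g v ((chartAt E g).map_source hh),
    (chartAt E g).left_inv hh]

lemma JetZero.lieDeriv {f : G → V} (hf : ContMDiff 𝓘(ℝ, E) 𝓘(ℝ, V) ∞ f) {g : G} {n : ℕ}
    (h : JetZero (n + 1) (f ∘ (chartAt E g).symm) (chartAt E g g)) (v : E) :
    JetZero n (lieDeriv E v f ∘ (chartAt E g).symm) (chartAt E g g) := by
  refine JetZero.congr ?_ (lieDeriv_chart_symm_eventuallyEq hf g v).symm
  exact (jetZero_succ_iff.1 h).2.bilinear (ContinuousLinearMap.id ℝ (E →L[ℝ] V))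
    (contDiffAt_fderiv_comp_chart_symm hf g)
    ((contDiffAt_translationDeriv g).clm_apply contDiffAt_const)

/-- Translation by `g⁻¹`, read in the same charts, is a smooth local inverse. -/
lemma exists_translationDeriv_eq (g : G) :
    ∃ e : E ≃L[ℝ] E, translationDeriv g (chartAt E g g) = e := by
  let c : E → E := fun z => chartAt E g (g * (chartAt E (1 : G)).symm z)
  let d : E → E := fun y => chartAt E (1 : G) (g⁻¹ * (chartAt E g).symm y)
  have hc : ContDiffAt ℝ ∞ c (oneCoord E G) :=
    contDiffAt_chart_mul_chart_symm (mem_chart_source E g)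
  have hc0 : c (oneCoord E G) = chartAt E g g := by simp [c]
  have hd0 : d (chartAt E g g) = oneCoord E G := by simp [d, oneCoord]
  have hgs : ContMDiffAt 𝓘(ℝ, E) 𝓘(ℝ, E) ∞ (fun y => g⁻¹ * (chartAt E g).symm y)
      (chartAt E g g) :=
    contMDiffAt_const.mul (contMDiffAt_chart_symm_of_mem (mem_chart_target E g))
  have hd : ContDiffAt ℝ ∞ d (chartAt E g g) := by
    rw [← contMDiffAt_iff_contDiffAt]
    refine ContMDiffAt.comp (I' := 𝓘(ℝ, E)) (g := chartAt E (1 : G)) (chartAt E g g) ?_ hgs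
    apply contMDiffAt_chart_of_mem
    simp
  have hdc : d ∘ c =ᶠ[𝓝 (oneCoord E G)] id := by
    have h1 := (contMDiffAt_mul_chart_symm (E := E) g).continuousAt
    have h2 : (chartAt E g).source ∈ 𝓝 (g * (chartAt E (1 : G)).symm (oneCoord E G)) :=
      (chartAt E g).open_source.mem_nhds (by simp)
    filter_upwards [h1 h2, (chartAt E (1 : G)).open_target.mem_nhds oneCoord_mem_target]
      with z hz hz'
    simp only [Function.comp_apply, c, d]
    rw [(chartAt E g).left_inv hz]
    simp [(chartAt E (1 : G)).right_inv hz']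
  have hcd : c ∘ d =ᶠ[𝓝 (chartAt E g g)] id := by
    have h2 : (chartAt E (1 : G)).source ∈ 𝓝 (g⁻¹ * (chartAt E g).symm (chartAt E g g)) :=
      (chartAt E (1 : G)).open_source.mem_nhds (by simp)
    filter_upwards [hgs.continuousAt h2,
      (chartAt E g).open_target.mem_nhds (mem_chart_target E g)] with z hz hz'
    simp only [Function.comp_apply, c, d]
    rw [(chartAt E (1 : G)).left_inv hz]
    simp [(chartAt E g).right_inv hz']
  have hd' : DifferentiableAt ℝ d (chartAt E g g) := hd.differentiableAt (by simp)
  have hc' : DifferentiableAt ℝ c (oneCoord E G) := hc.differentiableAt (by simp)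
  have e1 : (fderiv ℝ d (chartAt E g g)).comp (fderiv ℝ c (oneCoord E G)) =
      ContinuousLinearMap.id ℝ E := by
    rw [← hc0, ← fderiv_comp _ (hc0 ▸ hd') hc', hdc.fderiv_eq, fderiv_id]
  have e2 : (fderiv ℝ c (oneCoord E G)).comp (fderiv ℝ d (chartAt E g g)) =
      ContinuousLinearMap.id ℝ E := by
    rw [← hd0, ← fderiv_comp _ (hd0 ▸ hc') hd', hcd.fderiv_eq, fderiv_id]
  refine ⟨ContinuousLinearEquiv.equivOfInverse (fderiv ℝ c (oneCoord E G))
    (fderiv ℝ d (chartAt E g g)) (fun z => DFunLike.congr_fun e1 z)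
    (fun z => DFunLike.congr_fun e2 z), ?_⟩
  ext z
  simp only [translationDeriv, (chartAt E g).left_inv (mem_chart_source E g)]
  rfl

/-- The left-invariant fields form a frame, so `df` is the sum of the `X_i f` times a smooth dual
coframe. By Leibniz the `n`-jet of `df` vanishes along with those of the `X_i f`. -/
lemma jetZero_succ_of_lieDeriv [FiniteDimensional ℝ E] {f : G → V}
    (hf : ContMDiff 𝓘(ℝ, E) 𝓘(ℝ, V) ∞ f) {g : G} {n : ℕ}
    (h0 : f g = 0) (h : ∀ i, JetZero n
      (lieDeriv E (Module.finBasis ℝ E i) f ∘ (chartAt E g).symm) (chartAt E g g)) :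
    JetZero (n + 1) (f ∘ (chartAt E g).symm) (chartAt E g g) := by
  have := FiniteDimensional.complete ℝ E
  refine jetZero_succ_iff.2 ⟨by simpa using h0, ?_⟩
  obtain ⟨e, he⟩ := exists_translationDeriv_eq (E := E) g
  have hA := contDiffAt_translationDeriv (E := E) g
  have hAinv : ContDiffAt ℝ ∞ (fun y => (translationDeriv (E := E) g y).inverse)
      (chartAt E g g) :=
    ContDiffAt.comp (g := ContinuousLinearMap.inverse) (chartAt E g g)
      (he ▸ contDiffAt_map_inverse e) hA
  let b := Module.finBasis ℝ E
  let B : V →L[ℝ] (E →L[ℝ] ℝ) →L[ℝ] (E →L[ℝ] V) := (ContinuousLinearMap.smulRightL ℝ E V).flip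
  have hX : ∀ i, ContDiffAt ℝ ∞ (lieDeriv E (b i) f ∘ (chartAt E g).symm) (chartAt E g g) :=
    fun i => contDiffAt_comp_chart_symm (contMDiff_lieDeriv hf _) g (mem_chart_target E g)
  have hl : ∀ i, ContDiffAt ℝ ∞ (fun y => ((b.coord i).toContinuousLinearMap).comp
      (translationDeriv (E := E) g y).inverse) (chartAt E g g) :=
    fun i => contDiffAt_const.clm_comp hAinv
  refine JetZero.congr (JetZero.sum (s := Finset.univ) (fun i _ => (h i).bilinear B (hX i) (hl i))
    fun i _ => ?_) ?_
  · exact B.isBoundedBilinearMap.contDiff.contDiffAt.comp (chartAt E g g) ((hX i).prodMk (hl i))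
  -- Invertibility is an open condition, so the frame expansion holds near `g`, as a statement about
  -- jets requires.
  have hunit : ∀ᶠ y in 𝓝 (chartAt E g g), ∃ e : E ≃L[ℝ] E, (e : E →L[ℝ] E) =
      translationDeriv g y := hA.continuousAt (he ▸ ContinuousLinearEquiv.nhds e)
  filter_upwards [hunit, (chartAt E g).open_target.mem_nhds (mem_chart_target E g)]
    with y ⟨e', he'⟩ hy
  ext w
  simp only [B, ContinuousLinearMap.flip_apply, ContinuousLinearMap.smulRightL_apply_apply,
    Function.comp_apply, lieDeriv_chart_symm hf g _ hy, sum_apply,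
    ContinuousLinearMap.smulRight_apply, ContinuousLinearMap.comp_apply, ← he',
    ContinuousLinearMap.inverse_equiv]
  have hw : w = ∑ i, (b.coord i (e'.symm w)) • e' (b i) := by
    simp_rw [← map_smul, ← map_sum]
    simp [b.sum_repr]
  conv_rhs => rw [hw, map_sum]
  simp [b]

/-- At the identity the second derivatives of `f` cancel by symmetry. What remains is a first
derivative in a direction given by the derivative of the frame, independent of `f`. -/
lemma exists_lieDeriv_commutator (v w : E) : ∃ u : E, ∀ f : G → V,
    ContMDiff 𝓘(ℝ, E) 𝓘(ℝ, V) ∞ f → ∀ g, lieDeriv E v (lieDeriv E w f) g -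
      lieDeriv E w (lieDeriv E v f) g = lieDeriv E u f g := by
  let A := translationDeriv (E := E) (1 : G)
  have hA : DifferentiableAt ℝ A (oneCoord E G) :=
    (contDiffAt_translationDeriv (1 : G)).differentiableAt (by simp)
  refine ⟨fderiv ℝ A (oneCoord E G) v w - fderiv ℝ A (oneCoord E G) w v, ?_⟩
  have h1 : ∀ (f : G → V) (u : E), lieDeriv E u f 1 =
      fderiv ℝ (f ∘ (chartAt E (1 : G)).symm) (oneCoord E G) u := fun f u => by
    simp only [lieDeriv, one_mul]; rfl
  have key : ∀ f : G → V, ContMDiff 𝓘(ℝ, E) 𝓘(ℝ, V) ∞ f → ∀ v w, lieDeriv E v (lieDeriv E w f) 1 =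
      fderiv ℝ (fderiv ℝ (f ∘ (chartAt E (1 : G)).symm)) (oneCoord E G) v w +
      fderiv ℝ (f ∘ (chartAt E (1 : G)).symm) (oneCoord E G) (fderiv ℝ A (oneCoord E G) v w) := by
    intro f hf v w
    have hd : DifferentiableAt ℝ (fderiv ℝ (f ∘ (chartAt E (1 : G)).symm)) (oneCoord E G) :=
      (contDiffAt_fderiv_comp_chart_symm hf 1).differentiableAt (by simp)
    have h2 : lieDeriv E w f ∘ (chartAt E (1 : G)).symm =ᶠ[𝓝 (oneCoord E G)] _ :=
      lieDeriv_chart_symm_eventuallyEq hf 1 w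
    rw [h1, h2.fderiv_eq]
    have h3 := hd.hasFDerivAt.clm_apply
      (hA.hasFDerivAt.clm_apply (hasFDerivAt_const w (oneCoord E G)))
    have h4 := h3.fderiv
    change fderiv ℝ (fun y => fderiv ℝ (f ∘ (chartAt E (1 : G)).symm) y (A y w))
      (oneCoord E G) v = _
    rw [h4]
    simp [A, translationDeriv_one_oneCoord, add_comm]
  -- Both sides commute with left translations, so the identity point is enough.
  suffices h : ∀ f : G → V, ContMDiff 𝓘(ℝ, E) 𝓘(ℝ, V) ∞ f → lieDeriv E v (lieDeriv E w f) 1 -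
      lieDeriv E w (lieDeriv E v f) 1 = lieDeriv E (fderiv ℝ A (oneCoord E G) v w -
        fderiv ℝ A (oneCoord E G) w v) f 1 by
    intro f hf g
    have := h (fun a => f (g * a)) (hf.comp contMDiff_mul_left)
    have e : ∀ u, lieDeriv E u (fun a => f (g * a)) = fun a => lieDeriv E u f (g * a) :=
      fun u => funext fun a => lieDeriv_comp_mul_left u f a g
    simp only [e, lieDeriv_comp_mul_left, mul_one] at this
    exact this
  intro f hf
  have hsymm : IsSymmSndFDerivAt ℝ (f ∘ (chartAt E (1 : G)).symm) (oneCoord E G) :=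
    (contDiffAt_comp_chart_symm hf 1 oneCoord_mem_target).isSymmSndFDerivAt
      (by simpa using ENat.LEInfty.out)
  rw [key f hf, key f hf, h1, hsymm.eq v w, map_sub]
  abel

end InvariantFields

/-! ### The adjoint representation -/

section Adjoint

variable {E : Type*} [NormedAddCommGroup E] [NormedSpace ℝ E]
variable {G : Type*} [TopologicalSpace G] [ChartedSpace E G] [Group G] [LieGroup 𝓘(ℝ, E) ∞ G]
variable {V : Type*} [NormedAddCommGroup V] [NormedSpace ℝ V]

variable (E) in
/-- The adjoint representation, in the chart at the identity. -/
def adjointRep (k : G) : E →L[ℝ] E :=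
  fderiv ℝ (fun z => chartAt E (1 : G) (k * (chartAt E (1 : G)).symm z * k⁻¹)) (oneCoord E G)

/-- Conjugation is jointly smooth in both variables, so its derivative at the identity varies
continuously. This supplies continuous coefficients for the averaging. -/
lemma continuous_adjointRep : Continuous (adjointRep E : G → E →L[ℝ] E) := by
  rw [continuous_iff_continuousAt]
  intro k₀
  let B : E → E →L[ℝ] E := fun y => fderiv ℝ (fun z => chartAt E (1 : G)
    ((chartAt E k₀).symm y * (chartAt E (1 : G)).symm z * ((chartAt E k₀).symm y)⁻¹)) (oneCoord E G)
  have hB : ContDiffAt ℝ ∞ B (chartAt E k₀ k₀) := by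
    refine ContDiffAt.fderiv (n := ∞) (f := fun y z => chartAt E (1 : G)
      ((chartAt E k₀).symm y * (chartAt E (1 : G)).symm z * ((chartAt E k₀).symm y)⁻¹))
      (g := fun _ => oneCoord E G) ?_ contDiffAt_const (by simp)
    rw [← contMDiffAt_iff_contDiffAt]
    have h1 : ContMDiffAt 𝓘(ℝ, E × E) 𝓘(ℝ, E) ∞ (fun p : E × E => (chartAt E k₀).symm p.1)
        (chartAt E k₀ k₀, oneCoord E G) :=
      ContMDiffAt.comp (I' := 𝓘(ℝ, E)) (chartAt E k₀ k₀, oneCoord E G)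
        (contMDiffAt_chart_symm_of_mem (mem_chart_target E k₀)) contDiff_fst.contMDiff.contMDiffAt
    have h2 : ContMDiffAt 𝓘(ℝ, E × E) 𝓘(ℝ, E) ∞ (fun p : E × E => (chartAt E (1 : G)).symm p.2)
        (chartAt E k₀ k₀, oneCoord E G) :=
      ContMDiffAt.comp (I' := 𝓘(ℝ, E)) (chartAt E k₀ k₀, oneCoord E G)
        contMDiffAt_chart_symm_oneCoord contDiff_snd.contMDiff.contMDiffAt
    refine ContMDiffAt.comp (I' := 𝓘(ℝ, E)) (g := chartAt E (1 : G))
      (f := fun p : E × E => (chartAt E k₀).symm p.1 * (chartAt E (1 : G)).symm p.2 *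
        ((chartAt E k₀).symm p.1)⁻¹)
      (chartAt E k₀ k₀, oneCoord E G) ?_ ((h1.mul h2).mul h1.inv)
    apply contMDiffAt_chart_of_mem
    simp
  have hc : ContinuousAt (B ∘ chartAt E k₀) k₀ :=
    ContinuousAt.comp hB.continuousAt ((chartAt E k₀).continuousAt (mem_chart_source E k₀))
  refine hc.congr ?_
  filter_upwards [(chartAt E k₀).open_source.mem_nhds (mem_chart_source E k₀)] with k hk
  simp only [Function.comp_apply, B, adjointRep]
  rw [(chartAt E k₀).left_inv hk]

/-- The chain rule applied to `(g k) z k⁻¹ = g (k z k⁻¹)`. -/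
lemma lieDeriv_comp_mul_right {f : G → V} (hf : ContMDiff 𝓘(ℝ, E) 𝓘(ℝ, V) ∞ f) (v : E) (g k : G) :
    lieDeriv E v (fun a => f (a * k⁻¹)) (g * k) = lieDeriv E (adjointRep E k v) f g := by
  set c : E → E := fun z => chartAt E (1 : G) (k * (chartAt E (1 : G)).symm z * k⁻¹) with hc
  have hm : ContMDiffAt 𝓘(ℝ, E) 𝓘(ℝ, E) ∞ (fun z => k * (chartAt E (1 : G)).symm z * k⁻¹)
      (oneCoord E G) := (contMDiffAt_mul_chart_symm k).mul contMDiffAt_const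
  have hc0 : c (oneCoord E G) = oneCoord E G := by simp [hc, oneCoord]
  have hcd : ContDiffAt ℝ ∞ c (oneCoord E G) := by
    rw [← contMDiffAt_iff_contDiffAt]
    refine ContMDiffAt.comp (I' := 𝓘(ℝ, E)) (g := chartAt E (1 : G)) (oneCoord E G) ?_ hm
    apply contMDiffAt_chart_of_mem
    simp
  have hev : (fun z => f (g * k * (chartAt E (1 : G)).symm z * k⁻¹)) =ᶠ[𝓝 (oneCoord E G)]
      (fun y => f (g * (chartAt E (1 : G)).symm y)) ∘ c := by
    have h2 : (chartAt E (1 : G)).source ∈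
        𝓝 (k * (chartAt E (1 : G)).symm (oneCoord E G) * k⁻¹) :=
      (chartAt E (1 : G)).open_source.mem_nhds (by simp)
    filter_upwards [hm.continuousAt h2] with z hz
    simp only [Function.comp_apply, hc]
    rw [(chartAt E (1 : G)).left_inv hz]
    simp only [mul_assoc]
  have hfd : DifferentiableAt ℝ (fun y => f (g * (chartAt E (1 : G)).symm y)) (oneCoord E G) :=
    (contMDiffAt_iff_contDiffAt.1 (ContMDiffAt.comp (I' := 𝓘(ℝ, E)) (oneCoord E G)
      hf.contMDiffAt (contMDiffAt_mul_chart_symm g))).differentiableAt (by simp)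
  rw [lieDeriv, hev.fderiv_eq, fderiv_comp _ (hc0.symm ▸ hfd) (hcd.differentiableAt (by simp)), hc0]
  rfl

end Adjoint

end InvDiffOp
end

/-! ### Left-invariant differential operators on vector-valued functions -/

noncomputable section

namespace InvDiffOp

open Topology

/-- The action of a group on an algebra by inner automorphisms. -/
def conjRep {K W : Type*} [Group K] [Ring W] [Algebra ℂ W] (κ : K →* W) : K →* (W →ₐ[ℂ] W) where
  toFun k := AlgHom.ofLinearMap
    (LinearMap.mulRight ℂ (κ k⁻¹) ∘ₗ LinearMap.mulLeft ℂ (κ k))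
    (by simp [← map_mul]) (by
      intro a b
      simp only [LinearMap.comp_apply, LinearMap.mulLeft_apply, LinearMap.mulRight_apply]
      have : κ k⁻¹ * κ k = 1 := by simp [← map_mul]
      calc κ k * (a * b) * κ k⁻¹ = κ k * a * 1 * b * κ k⁻¹ := by simp only [mul_assoc, one_mul]
        _ = _ := by rw [← this]; simp only [mul_assoc])
  map_one' := by ext a; simp
  map_mul' k l := by ext a; simp [mul_assoc]

section Operators

variable (E : Type*) [NormedAddCommGroup E] [NormedSpace ℝ E]
variable (G : Type*) [TopologicalSpace G] [ChartedSpace E G]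
variable (V : Type*) [NormedAddCommGroup V] [InnerProductSpace ℂ V]

/-- The smooth functions `G → V`. -/
def smoothFunctions : Submodule ℂ (G → V) where
  carrier := {f | ContMDiff 𝓘(ℝ, E) 𝓘(ℝ, V) ∞ f}
  zero_mem' := contMDiff_const
  add_mem' hf hg := ContMDiff.add hf hg
  smul_mem' c _ hf :=
    (ContinuousLinearMap.contMDiff ((c • ContinuousLinearMap.id ℂ V).restrictScalars ℝ)).comp hf

variable {E G V}

lemma smoothFunctions_ext {f f' : smoothFunctions E G V} (h : ∀ g, f.1 g = f'.1 g) : f = f' :=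
  Subtype.ext (funext h)

lemma op_ext {a b : Module.End ℂ (smoothFunctions E G V)} (h : ∀ f g, (a f).1 g = (b f).1 g) :
    a = b :=
  LinearMap.ext fun f => smoothFunctions_ext (h f)

/-- Evaluation at `g`. -/
def evalAt (g : G) : smoothFunctions E G V →ₗ[ℂ] V :=
  LinearMap.proj g ∘ₗ (smoothFunctions E G V).subtype

lemma evalAt_apply (g : G) (f : smoothFunctions E G V) : evalAt g f = f.1 g := rfl

/-- Pointwise application of linear endomorphisms of `V`. -/
def constOp [FiniteDimensional ℂ V] :
    Module.End ℂ V →ₐ[ℂ] Module.End ℂ (smoothFunctions E G V) :=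
  AlgHom.ofLinearMap
    { toFun := fun L =>
        { toFun := fun f => ⟨fun g => L (f.1 g), (ContinuousLinearMap.contMDiff
            ((LinearMap.toContinuousLinearMap L).restrictScalars ℝ)).comp f.2⟩
          map_add' := fun f f' => smoothFunctions_ext fun g => map_add L (f.1 g) (f'.1 g)
          map_smul' := fun c f => smoothFunctions_ext fun g => map_smul L c (f.1 g) }
      map_add' := fun _ _ => rfl
      map_smul' := fun _ _ => rfl } rfl fun _ _ => rfl

variable [Group G] [LieGroup 𝓘(ℝ, E) ∞ G]

lemma differentiableAt_mul_chart_symm (f : smoothFunctions E G V) (g : G) :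
    DifferentiableAt ℝ (fun y => f.1 (g * (chartAt E (1 : G)).symm y)) (oneCoord E G) :=
  (contMDiffAt_iff_contDiffAt.1 (ContMDiffAt.comp (I' := 𝓘(ℝ, E)) (oneCoord E G)
    f.2.contMDiffAt (contMDiffAt_mul_chart_symm g))).differentiableAt (by simp)

/-- The left-invariant vector field with value `v` at the identity, as an operator. -/
def lieOp (v : E) : Module.End ℂ (smoothFunctions E G V) where
  toFun f := ⟨lieDeriv E v f.1, contMDiff_lieDeriv f.2 v⟩
  map_add' f f' := smoothFunctions_ext fun g => by
    change fderiv ℝ ((fun y => f.1 (g * (chartAt E (1 : G)).symm y)) +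
      fun y => f'.1 (g * (chartAt E (1 : G)).symm y)) (oneCoord E G) v = _
    rw [fderiv_add (differentiableAt_mul_chart_symm f g) (differentiableAt_mul_chart_symm f' g)]
    rfl
  map_smul' c f := smoothFunctions_ext fun g => by
    change fderiv ℝ (c • fun y => f.1 (g * (chartAt E (1 : G)).symm y)) (oneCoord E G) v = _
    rw [fderiv_const_smul (differentiableAt_mul_chart_symm f g)]
    rfl

lemma lieOp_apply (v : E) (f : smoothFunctions E G V) (g : G) :
    (lieOp v f).1 g = lieDeriv E v f.1 g := rfl

lemma lieOp_commute_constOp [FiniteDimensional ℂ V] (v : E) (L : Module.End ℂ V) :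
    Commute (lieOp v : Module.End ℂ (smoothFunctions E G V)) (constOp L) := by
  refine op_ext fun f g => ?_
  have := (((LinearMap.toContinuousLinearMap L).restrictScalars ℝ).hasFDerivAt.comp
    (oneCoord E G) (differentiableAt_mul_chart_symm f g).hasFDerivAt).fderiv
  exact DFunLike.congr_fun this v

variable [FiniteDimensional ℝ E]

lemma lieOp_eq_sum (v : E) : (lieOp v : Module.End ℂ (smoothFunctions E G V)) =
    ∑ i, ((Module.finBasis ℝ E).repr v i : ℂ) • lieOp (Module.finBasis ℝ E i) := by
  refine op_ext fun f g => ?_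
  rw [← evalAt_apply g ((∑ i, _ : Module.End ℂ (smoothFunctions E G V)) f), LinearMap.sum_apply,
    map_sum, lieOp_apply, lieDeriv]
  conv_lhs => rw [← (Module.finBasis ℝ E).sum_repr v, map_sum]
  refine Finset.sum_congr rfl fun i _ => ?_
  rw [map_smul, LinearMap.smul_apply, map_smul]
  exact (Complex.coe_smul _ _).symm

variable [FiniteDimensional ℂ V]

variable (E G V) in
/-- The algebra of operators of order zero. -/
abbrev constAlg : Subalgebra ℂ (Module.End ℂ (smoothFunctions E G V)) := constOp.range

variable (E G V) in
/-- A basis of the left-invariant vector fields. -/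
abbrev lieBasis (i : Fin (Module.finrank ℝ E)) : Module.End ℂ (smoothFunctions E G V) :=
  lieOp (Module.finBasis ℝ E i)

variable (E G V) in
/-- The left-invariant differential operators of order at most `n` on functions `G → V`. -/
abbrev invOp (n : ℕ) : Submodule ℂ (Module.End ℂ (smoothFunctions E G V)) :=
  fil (constAlg E G V) (lieBasis E G V) n

lemma constOp_mem_invOp (L : Module.End ℂ V) : constOp L ∈ invOp E G V 0 := ⟨L, rfl⟩

lemma lieOp_mem_invOp (v : E) : lieOp v ∈ invOp E G V 1 := by
  rw [lieOp_eq_sum]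
  exact Submodule.sum_mem _ fun i _ => Submodule.smul_mem _ _ (mem_fil_one i)

lemma lieOp_commute (i : Fin (Module.finrank ℝ E)) :
    ∀ a ∈ constAlg E G V, Commute (lieBasis E G V i) a := by
  rintro _ ⟨L, rfl⟩
  exact lieOp_commute_constOp _ L

lemma lieOp_commutator_mem (v w : E) : (lieOp v * lieOp w - lieOp w * lieOp v) ∈ invOp E G V 1 := by
  obtain ⟨u, hu⟩ := exists_lieDeriv_commutator (G := G) (V := V) v w
  have : (lieOp v * lieOp w - lieOp w * lieOp v : Module.End ℂ (smoothFunctions E G V)) =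
    lieOp u := op_ext fun f g => hu f.1 f.2 g
  rw [this]
  exact lieOp_mem_invOp u

/-- Left translation of functions. -/
def leftTranslate (h : G) : Module.End ℂ (smoothFunctions E G V) where
  toFun f := ⟨fun g => f.1 (h * g), f.2.comp contMDiff_mul_left⟩
  map_add' _ _ := rfl
  map_smul' _ _ := rfl

lemma apply_leftTranslate {n : ℕ} {a : Module.End ℂ (smoothFunctions E G V)}
    (ha : a ∈ invOp E G V n) (h : G) (f : smoothFunctions E G V) :
    a (leftTranslate h f) = leftTranslate h (a f) := by
  suffices H : invOp E G V n ≤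
      Subalgebra.toSubmodule (Subalgebra.centralizer ℂ {leftTranslate h}) by
    exact (LinearMap.congr_fun ((Subalgebra.mem_centralizer_iff ℂ).1 (H ha) _ rfl) f).symm
  clear ha
  have h1 : ∀ v, (lieOp v : Module.End ℂ (smoothFunctions E G V)) ∈
      Subalgebra.centralizer ℂ {leftTranslate h} := by
    intro v
    rw [Subalgebra.mem_centralizer_iff]
    rintro _ rfl
    exact op_ext fun f g => (lieDeriv_comp_mul_left v f.1 g h).symm
  induction n with
  | zero =>
    rintro _ ⟨L, rfl⟩
    refine (Subalgebra.mem_centralizer_iff ℂ).2 ?_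
    rintro _ rfl
    rfl
  | succ n ih => exact fil_succ_le ih fun i a ha => Subalgebra.mul_mem _ (h1 _) (ih ha)

lemma apply_eq_apply_one {n : ℕ} {a : Module.End ℂ (smoothFunctions E G V)}
    (ha : a ∈ invOp E G V n) (f : smoothFunctions E G V) (g : G) :
    (a f).1 g = (a (leftTranslate g f)).1 1 := by
  rw [apply_leftTranslate ha]
  change (a f).1 g = (a f).1 (g * 1)
  rw [mul_one]

/-- Each vector field costs one order of vanishing, and a constant endomorphism costs none. -/
lemma jetVanishes_apply {m n : ℕ} {a : Module.End ℂ (smoothFunctions E G V)}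
    (ha : a ∈ invOp E G V n) {f : smoothFunctions E G V} {g : G}
    (hf : JetVanishes E (n + m) f.1 g) : JetVanishes E m (a f).1 g := by
  let P (m : ℕ) : Submodule ℂ (smoothFunctions E G V) :=
    { carrier := {f | JetVanishes E m f.1 g}
      zero_mem' := fun j _ => by
        change iteratedFDeriv ℝ j (fun _ => (0 : V)) _ = 0
        simp
      add_mem' := fun {f f'} hf hf' j hj => by
        change iteratedFDeriv ℝ j ((f.1 ∘ (chartAt E g).symm) + f'.1 ∘ (chartAt E g).symm) _ = 0
        rw [iteratedFDeriv_add_apply, hf j hj, hf' j hj, add_zero]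
        · exact (contDiffAt_comp_chart_symm f.2 g (mem_chart_target E g)).of_le
            (by exact_mod_cast le_top)
        · exact (contDiffAt_comp_chart_symm f'.2 g (mem_chart_target E g)).of_le
            (by exact_mod_cast le_top)
      smul_mem' := fun c f hf => JetZero.clm_comp (F' := V) hf
        ((c • ContinuousLinearMap.id ℂ V).restrictScalars ℝ)
        (contDiffAt_comp_chart_symm f.2 g (mem_chart_target E g)) }
  suffices H : ∀ n m, invOp E G V n ≤
      { carrier := {a | ∀ f ∈ P (n + m), a f ∈ P m}
        zero_mem' := fun f _ => (P m).zero_mem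
        add_mem' := fun ha hb f hf => (P m).add_mem (ha f hf) (hb f hf)
        smul_mem' := fun c _ ha f hf => (P m).smul_mem c (ha f hf) } from H n m ha f hf
  intro n
  induction n with
  | zero =>
    rintro m _ ⟨L, rfl⟩ f hf
    refine JetZero.clm_comp (F' := V) (fun j hj => hf j (by omega))
      ((LinearMap.toContinuousLinearMap L).restrictScalars ℝ)
      (contDiffAt_comp_chart_symm f.2 g (mem_chart_target E g))
  | succ n ih =>
    intro m
    refine fil_succ_le (fun a ha f hf => ih m ha f fun j hj => hf j (by omega))
      fun i a ha f hf => ?_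
    have : a f ∈ P (m + 1) := ih (m + 1) ha f fun j hj => hf j (by omega)
    exact JetZero.lieDeriv (a f).2 this _

variable (E G V) in
-- Iterating `jetZero_succ_of_lieDeriv` yields the monomials of degree at most `n` in the basis
-- fields; the operator `1` tests the value itself.
lemma exists_finite_jetVanishes (n : ℕ) : ∃ s : Set (Module.End ℂ (smoothFunctions E G V)),
    s.Finite ∧ s ⊆ invOp E G V n ∧
      ∀ (f : smoothFunctions E G V) (g : G), (∀ w ∈ s, (w f).1 g = 0) → JetVanishes E n f.1 g := by
  induction n with
  | zero =>
    refine ⟨{1}, Set.finite_singleton _, ?_, fun f g h => ?_⟩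
    · rintro _ rfl
      exact Subalgebra.one_mem _
    · refine jetZero_zero_iff.2 ?_
      simpa using h 1 rfl
  | succ n ih =>
    obtain ⟨s, hs, hsn, h⟩ := ih
    refine ⟨insert 1 (Set.image2 (fun w i => w * lieOp (Module.finBasis ℝ E i)) s Set.univ),
      (hs.image2 _ Set.finite_univ).insert 1, Set.insert_subset_iff.2 ⟨?_, ?_⟩, fun f g hf => ?_⟩
    · exact fil_mono (Nat.zero_le _) (Subalgebra.one_mem _)
    · rintro _ ⟨w, hw, i, -, rfl⟩
      exact mul_mem_fil lieOp_commute (hsn hw) (mem_fil_one i)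
    · refine jetZero_succ_of_lieDeriv f.2 (hf 1 (Set.mem_insert _ _)) fun i => ?_
      exact h (lieOp (Module.finBasis ℝ E i) f) g fun w hw =>
        hf _ (Set.mem_insert_of_mem _ ⟨w, hw, i, trivial, rfl⟩)

end Operators

end InvDiffOp
end

noncomputable section

namespace InvDiffOp

open Topology

/-! ### From invariant operators on functions to operators on sections -/

section Sections

variable {G : Type*} [Group G] {K : Subgroup G}
variable {V : Type*} [NormedAddCommGroup V] [InnerProductSpace ℂ V]

lemma pullback_mul (τ : K →* (V ≃ₗᵢ[ℂ] V)) (s : (x : G ⧸ K) → AssocBundle.Fiber τ x) (g : G)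
    (k : K) : τ k (pullback τ s (g * k)) = pullback τ s g := by
  apply AssocBundle.mk_injective τ g
  rw [← AssocBundle.mk_mul, mk_pullback, mk_pullback]
  have : ((g * k : G) : G ⧸ K) = (g : G ⧸ K) := QuotientGroup.eq.2 (by simp)
  rw [this]

lemma pullback_injective (τ : K →* (V ≃ₗᵢ[ℂ] V)) :
    Function.Injective (pullback τ : ((x : G ⧸ K) → AssocBundle.Fiber τ x) → G → V) := by
  intro s t h
  funext x
  induction x using QuotientGroup.induction_on with
  | H g => exact (AssocBundle.frameL τ g (g : G ⧸ K) rfl).symm.injective (congrFun h g)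

lemma pullback_eq_zero_iff (τ : K →* (V ≃ₗᵢ[ℂ] V)) (s : (x : G ⧸ K) → AssocBundle.Fiber τ x)
    (g : G) : pullback τ s g = 0 ↔ s (g : G ⧸ K) = 0 :=
  LinearEquiv.map_eq_zero_iff _

/-- The section `gK ↦ [g, f(g)]` given by an equivariant function `f`. -/
def sectionOf (τ : K →* (V ≃ₗᵢ[ℂ] V)) (f : G → V) (x : G ⧸ K) : AssocBundle.Fiber τ x :=
  AssocBundle.frameL τ x.out x (QuotientGroup.out_eq' x) (f x.out)

lemma pullback_sectionOf (τ : K →* (V ≃ₗᵢ[ℂ] V)) {f : G → V}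
    (hf : ∀ (g : G) (k : K), τ k (f (g * k)) = f g) : pullback τ (sectionOf τ f) = f := by
  funext g
  apply AssocBundle.mk_injective τ g
  rw [mk_pullback]
  change AssocBundle.mk τ (g : G ⧸ K).out (f (g : G ⧸ K).out) = _
  obtain ⟨k, hk⟩ : ∃ k : K, (g : G ⧸ K).out = g * k := QuotientGroup.mk_out_eq_mul K g
  rw [hk, AssocBundle.mk_mul, hf]

variable {E : Type*} [NormedAddCommGroup E] [NormedSpace ℝ E]
variable [TopologicalSpace G] [ChartedSpace E G]

/-- The smooth function `f` with `s(gK) = [g, f(g)]`. -/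
def pullbackSmooth (τ : K →* (V ≃ₗᵢ[ℂ] V)) : SmoothSections E τ →ₗ[ℂ] smoothFunctions E G V where
  toFun s := ⟨pullback τ s.1, s.2⟩
  map_add' s t := smoothFunctions_ext fun g => map_add _ (s.1 g) (t.1 g)
  map_smul' c s := smoothFunctions_ext fun g => map_smul _ c (s.1 g)

lemma pullbackSmooth_injective (τ : K →* (V ≃ₗᵢ[ℂ] V)) :
    Function.Injective (pullbackSmooth (E := E) τ) := fun _ _ h =>
  Subtype.ext (pullback_injective τ (congrArg Subtype.val h))

lemma ext_pullbackSmooth {τ : K →* (V ≃ₗᵢ[ℂ] V)} {D D' : Module.End ℂ (SmoothSections E τ)}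
    (h : ∀ s, pullbackSmooth τ (D s) = pullbackSmooth τ (D' s)) : D = D' :=
  LinearMap.ext fun s => pullbackSmooth_injective τ (h s)

variable [LieGroup 𝓘(ℝ, E) ∞ G]

lemma pullbackSmooth_translateSmooth (τ : K →* (V ≃ₗᵢ[ℂ] V)) (g : G) (s : SmoothSections E τ) :
    pullbackSmooth τ (translateSmooth E τ g s) = leftTranslate g⁻¹ (pullbackSmooth τ s) :=
  smoothFunctions_ext fun a => pullback_translate τ g s.1 a

variable (E) in
/-- The action `(k f)(g) = τ(k) f(g k)` of `K` on functions, whose invariants correspond to the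
sections of the bundle. -/
def rightAction (τ : K →* (V ≃ₗᵢ[ℂ] V)) : K →* Module.End ℂ (smoothFunctions E G V) where
  toFun k :=
    { toFun := fun f => ⟨fun g => τ k (f.1 (g * k)),
        (ContinuousLinearMap.contMDiff
          (((τ k).toContinuousLinearEquiv : V →L[ℂ] V).restrictScalars ℝ)).comp
          (f.2.comp contMDiff_mul_right)⟩
      map_add' := fun f f' => smoothFunctions_ext fun g => map_add (τ k) _ _
      map_smul' := fun c f => smoothFunctions_ext fun g => map_smul (τ k) c _ }
  map_one' := op_ext fun f g => by simp
  map_mul' k l := op_ext fun f g => by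
    change τ (k * l) (f.1 (g * (k * l : K))) = τ k (τ l (f.1 (g * k * l)))
    rw [rep_mul, Subgroup.coe_mul, mul_assoc]

lemma rightAction_apply (τ : K →* (V ≃ₗᵢ[ℂ] V)) (k : K) (f : smoothFunctions E G V) (g : G) :
    (rightAction E τ k f).1 g = τ k (f.1 (g * k)) := rfl

lemma rightAction_pullbackSmooth (τ : K →* (V ≃ₗᵢ[ℂ] V)) (k : K) (s : SmoothSections E τ) :
    rightAction E τ k (pullbackSmooth τ s) = pullbackSmooth τ s :=
  smoothFunctions_ext fun g => pullback_mul τ s.1 g k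

lemma exists_pullbackSmooth_eq (τ : K →* (V ≃ₗᵢ[ℂ] V)) {f : smoothFunctions E G V}
    (hf : ∀ k, rightAction E τ k f = f) : ∃ s, pullbackSmooth τ s = f := by
  have h : pullback τ (sectionOf τ f.1) = f.1 :=
    pullback_sectionOf τ fun g k => congrFun (congrArg Subtype.val (hf k)) g
  exact ⟨⟨sectionOf τ f.1, show ContMDiff _ _ _ (pullback τ _) by rw [h]; exact f.2⟩, Subtype.ext h⟩

variable (E) in
/-- The action of `K` on operators by conjugation. -/
def opConj (τ : K →* (V ≃ₗᵢ[ℂ] V)) :=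
  conjRep (W := Module.End ℂ (smoothFunctions E G V)) (rightAction E τ)

lemma opConj_apply (τ : K →* (V ≃ₗᵢ[ℂ] V)) (k : K) (a : Module.End ℂ (smoothFunctions E G V))
    (f : smoothFunctions E G V) :
    opConj E τ k a f = rightAction E τ k (a (rightAction E τ k⁻¹ f)) := rfl

lemma opConj_pullbackSmooth (τ : K →* (V ≃ₗᵢ[ℂ] V)) (k : K)
    (a : Module.End ℂ (smoothFunctions E G V)) (s : SmoothSections E τ) :
    opConj E τ k a (pullbackSmooth τ s) =
      rightAction E τ k (a (pullbackSmooth τ s)) := by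
  rw [opConj_apply, rightAction_pullbackSmooth]

/-- An invariant operator is determined by its values at the identity coset. -/
lemma pullback_apply_of_invariant {τ : K →* (V ≃ₗᵢ[ℂ] V)} {D : Module.End ℂ (SmoothSections E τ)}
    (hD : IsInvariantDifferentialOperator D) (s : SmoothSections E τ) (g : G) :
    (pullbackSmooth τ (D s)).1 g = (pullbackSmooth τ (D (translateSmooth E τ g⁻¹ s))).1 1 := by
  rw [hD.2, pullbackSmooth_translateSmooth]
  change _ = (pullbackSmooth τ (D s)).1 (g⁻¹⁻¹ * 1)
  simp

variable [FiniteDimensional ℂ V]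

lemma opConj_constOp (τ : K →* (V ≃ₗᵢ[ℂ] V)) (k : K) (L : Module.End ℂ V) :
    opConj E τ k (constOp L) =
      constOp ((τ k).toLinearEquiv.toLinearMap ∘ₗ L ∘ₗ (τ k⁻¹).toLinearEquiv.toLinearMap) := by
  refine op_ext fun f g => ?_
  rw [opConj_apply]
  change τ k (L (τ k⁻¹ (f.1 (g * k * (k⁻¹ : K))))) = τ k (L (τ k⁻¹ (f.1 g)))
  simp

/-- The constant endomorphisms `τ k` commute with the field, so only right translation matters, and
it acts through the adjoint representation. -/
lemma opConj_lieOp (τ : K →* (V ≃ₗᵢ[ℂ] V)) (k : K) (v : E) :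
    opConj E τ k (lieOp v) = lieOp (adjointRep E (k : G) v) := by
  refine op_ext fun f g => ?_
  rw [opConj_apply, lieOp_apply, ← lieDeriv_comp_mul_right f.2]
  have h1 : (rightAction E τ k⁻¹ f) = constOp (τ k⁻¹).toLinearEquiv.toLinearMap
      ⟨fun a => f.1 (a * (k : G)⁻¹), f.2.comp contMDiff_mul_right⟩ := rfl
  rw [h1, rightAction_apply,
    ← Module.End.mul_apply (lieOp v), (lieOp_commute_constOp v _).eq]
  change τ k (τ k⁻¹ _) = _
  rw [← rep_mul, mul_inv_cancel, map_one]
  rfl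

/-- In matrix units of an orthonormal basis, the coefficients of the conjugate are matrix
coefficients `⟨τ(k⁻¹) b_i, L τ(k⁻¹) b_j⟩`, which are continuous in `k`. -/
lemma opConj_constOp_mem {τ : K →* (V ≃ₗᵢ[ℂ] V)} (hτ : ∀ v, Continuous fun k => τ k v)
    [IsTopologicalGroup G] :
    ∀ a ∈ constAlg E G V, (fun k => opConj E τ k a) ∈
      finiteFunctions K (Subalgebra.toSubmodule (constAlg E G V)) := by
  rintro _ ⟨L, rfl⟩
  let b := stdOrthonormalBasis ℂ V
  let e (i j) : Module.End ℂ V := (InnerProductSpace.rankOne ℂ (b i) (b j)).toLinearMap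
  have hinv : ∀ v, Continuous fun k => τ k⁻¹ v := fun v => (hτ v).comp continuous_inv
  have key : (fun k => opConj E τ k (constOp L)) = ∑ i, ∑ j, fun k =>
      (inner ℂ (τ k⁻¹ (b i)) (L (τ k⁻¹ (b j))) : ℂ) •
        (constOp (e i j) : Module.End ℂ (smoothFunctions E G V)) := by
    funext k
    rw [opConj_constOp]
    simp only [Finset.sum_apply, ← map_smul, ← map_sum]
    congr 1
    refine b.toBasis.ext fun l => ?_
    simp only [LinearMap.sum_apply, LinearMap.smul_apply, OrthonormalBasis.coe_toBasis]
    have hl : ∀ i j, e i j (b l) = if j = l then b i else 0 := by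
      intro i j
      change inner ℂ (b j) (b l) • b i = _
      rw [orthonormal_iff_ite.1 b.orthonormal j l]
      split_ifs <;> simp
    simp only [hl, smul_ite, smul_zero, Finset.sum_ite_eq', Finset.mem_univ, if_true]
    change τ k (L (τ k⁻¹ (b l))) = _
    conv_lhs => rw [← b.sum_repr (τ k (L (τ k⁻¹ (b l))))]
    refine Finset.sum_congr rfl fun i _ => ?_
    rw [b.repr_apply_apply, ← (τ k⁻¹).inner_map_map, ← rep_mul, inv_mul_cancel, map_one]
    rfl
  change (fun k => opConj E τ k (constOp L)) ∈ _
  rw [key]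
  refine Submodule.sum_mem _ fun i _ => Submodule.sum_mem _ fun j _ =>
    smul_mem_finiteFunctions ?_ ⟨e i j, rfl⟩
  exact (hinv _).inner ((LinearMap.toContinuousLinearMap L).continuous.comp (hinv _))

lemma opConj_lieOp_mem [FiniteDimensional ℝ E] (τ : K →* (V ≃ₗᵢ[ℂ] V)) (v : E) :
    (fun k => opConj E τ k (lieOp v)) ∈ finiteFunctions K (invOp E G V 1) := by
  have key : (fun k => opConj E τ k (lieOp v)) = ∑ i, fun k : K =>
      ((Module.finBasis ℝ E).repr (adjointRep E (k : G) v) i : ℂ) • lieBasis E G V i := by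
    funext k
    rw [opConj_lieOp, lieOp_eq_sum, Finset.sum_apply]
  rw [key]
  refine Submodule.sum_mem _ fun i _ => smul_mem_finiteFunctions ?_ (mem_fil_one i)
  have h1 : Continuous ((Module.finBasis ℝ E).coord i) :=
    LinearMap.continuous_of_finiteDimensional _
  exact Complex.continuous_ofReal.comp (h1.comp
    ((continuous_adjointRep.comp continuous_subtype_val).clm_apply continuous_const))

variable [FiniteDimensional ℝ E]

instance : Module.Finite ℂ (constAlg E G V) :=
  inferInstanceAs (Module.Finite ℂ
    (LinearMap.range (constOp (E := E) (G := G) (V := V)).toLinearMap))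

variable (E) in
/-- The left-invariant differential operators on functions that commute with `K`. -/
abbrev invariantOps (τ : K →* (V ≃ₗᵢ[ℂ] V)) :
    Subalgebra ℂ (Module.End ℂ (smoothFunctions E G V)) :=
  filInvariants (constAlg E G V) (lieBasis E G V) (opConj E τ) lieOp_commute

lemma exists_pullbackSmooth_eq_apply (τ : K →* (V ≃ₗᵢ[ℂ] V)) (a : invariantOps E τ)
    (s : SmoothSections E τ) : ∃ t, pullbackSmooth τ t = a.1 (pullbackSmooth τ s) :=
  exists_pullbackSmooth_eq τ fun k => by
    rw [← opConj_pullbackSmooth, a.2.2 k]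

/-- The operator on sections given by an invariant operator on functions. -/
def onSections (τ : K →* (V ≃ₗᵢ[ℂ] V)) (a : invariantOps E τ) :
    Module.End ℂ (SmoothSections E τ) :=
  (LinearEquiv.ofInjective _ (pullbackSmooth_injective τ)).symm.toLinearMap ∘ₗ
    (a.1 ∘ₗ pullbackSmooth τ).codRestrict (LinearMap.range (pullbackSmooth τ))
      (exists_pullbackSmooth_eq_apply τ a)

lemma pullbackSmooth_onSections (τ : K →* (V ≃ₗᵢ[ℂ] V)) (a : invariantOps E τ)
    (s : SmoothSections E τ) : pullbackSmooth τ (onSections τ a s) = a.1 (pullbackSmooth τ s) :=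
  congrArg Subtype.val ((LinearEquiv.ofInjective _ (pullbackSmooth_injective τ)).apply_symm_apply
    ((a.1 ∘ₗ pullbackSmooth τ).codRestrict (LinearMap.range (pullbackSmooth τ))
      (exists_pullbackSmooth_eq_apply τ a) s))

/-- The action of the invariant operators on sections. -/
def toSections (τ : K →* (V ≃ₗᵢ[ℂ] V)) :
    invariantOps E τ →ₐ[ℂ] Module.End ℂ (SmoothSections E τ) :=
  AlgHom.ofLinearMap
    { toFun := onSections τ
      map_add' := fun a b => ext_pullbackSmooth fun s => by
        rw [LinearMap.add_apply, map_add, pullbackSmooth_onSections, pullbackSmooth_onSections,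
          pullbackSmooth_onSections]
        rfl
      map_smul' := fun c a => ext_pullbackSmooth fun s => by
        rw [LinearMap.smul_apply, map_smul, pullbackSmooth_onSections, pullbackSmooth_onSections]
        rfl }
    (ext_pullbackSmooth fun s => pullbackSmooth_onSections τ 1 s)
    (fun a b => ext_pullbackSmooth fun s => by
      change pullbackSmooth τ (onSections τ (a * b) s) =
        pullbackSmooth τ (onSections τ a (onSections τ b s))
      rw [pullbackSmooth_onSections, pullbackSmooth_onSections, pullbackSmooth_onSections]
      rfl)

lemma pullbackSmooth_toSections (τ : K →* (V ≃ₗᵢ[ℂ] V)) (a : invariantOps E τ)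
    (s : SmoothSections E τ) :
    pullbackSmooth τ (toSections τ a s) = a.1 (pullbackSmooth τ s) :=
  pullbackSmooth_onSections τ a s

lemma isInvariantDifferentialOperator_toSections (τ : K →* (V ≃ₗᵢ[ℂ] V)) (a : invariantOps E τ) :
    IsInvariantDifferentialOperator (toSections τ a) := by
  obtain ⟨n, hn⟩ := a.2.1
  refine ⟨⟨n, fun s g h => ?_⟩, fun g s => pullbackSmooth_injective τ ?_⟩
  · rw [← pullback_eq_zero_iff]
    change (pullbackSmooth τ (toSections τ a s)).1 g = 0
    rw [pullbackSmooth_toSections]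
    have h0 : JetVanishes E 0 (a.1 (pullbackSmooth τ s)).1 g := jetVanishes_apply hn h
    have := jetZero_zero_iff.1 h0
    simpa using this
  · rw [pullbackSmooth_toSections, pullbackSmooth_translateSmooth, apply_leftTranslate hn,
      pullbackSmooth_translateSmooth, pullbackSmooth_toSections]

/-- A linear map that vanishes on the kernel of another one factors through it. -/
lemma exists_comp_eq_of_ker_le {A B C : Type*} [AddCommGroup A] [Module ℂ A] [AddCommGroup B]
    [Module ℂ B] [AddCommGroup C] [Module ℂ C] (p : A →ₗ[ℂ] B) (q : A →ₗ[ℂ] C)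
    (h : ∀ a, p a = 0 → q a = 0) : ∃ r : B →ₗ[ℂ] C, ∀ a, r (p a) = q a := by
  obtain ⟨t, ht⟩ := p.rangeRestrict.exists_rightInverse_of_surjective p.range_rangeRestrict
  obtain ⟨r, hr⟩ := LinearMap.exists_extend (q ∘ₗ t)
  refine ⟨r, fun a => ?_⟩
  have h1 : r (p a) = q (t (p.rangeRestrict a)) := LinearMap.congr_fun hr (p.rangeRestrict a)
  rw [h1, ← sub_eq_zero, ← map_sub]
  apply h
  have h2 : p (t (p.rangeRestrict a)) = p a :=
    congrArg Subtype.val (LinearMap.congr_fun ht (p.rangeRestrict a))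
  rw [map_sub, h2, sub_self]

/-- At the identity, a differential operator on sections is given by a left-invariant operator on
functions. -/
lemma exists_invOp_eq_at_one {τ : K →* (V ≃ₗᵢ[ℂ] V)} {D : Module.End ℂ (SmoothSections E τ)}
    (hD : IsDifferentialOperator D) : ∃ n, ∃ a ∈ invOp E G V n, ∀ s,
      (a (pullbackSmooth τ s)).1 1 = (pullbackSmooth τ (D s)).1 1 := by
  obtain ⟨n, hn⟩ := hD
  obtain ⟨w, hw, hwn, hjet⟩ := exists_finite_jetVanishes E G V n
  have := hw.fintype
  classical
  let p : SmoothSections E τ →ₗ[ℂ] (w → V) :=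
    LinearMap.pi fun i => evalAt (1 : G) ∘ₗ i.1 ∘ₗ pullbackSmooth τ
  let q : SmoothSections E τ →ₗ[ℂ] V := evalAt (1 : G) ∘ₗ pullbackSmooth τ ∘ₗ D
  -- If all test values in `w` vanish at `1`, so does the `n`-jet, and hence `(D s)(1)`. The
  -- components of the factoring map `r` then serve as the zeroth-order coefficients of the
  -- operator.
  obtain ⟨r, hr⟩ := exists_comp_eq_of_ker_le p q (fun s hs => by
    refine (pullback_eq_zero_iff τ _ _).2 (hn s 1 (hjet (pullbackSmooth τ s) 1 fun i hi => ?_))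
    exact congrFun hs ⟨i, hi⟩)
  refine ⟨n, ∑ i : w, constOp (r ∘ₗ LinearMap.single ℂ (fun _ : w => V) i) * i.1,
    Submodule.sum_mem _ fun i _ => ?_, fun s => ?_⟩
  · have := mul_mem_fil lieOp_commute
      (constOp_mem_invOp (r ∘ₗ LinearMap.single ℂ (fun _ : w => V) i)) (hwn i.2)
    rwa [Nat.zero_add] at this
  · have h1 := hr s
    rw [← evalAt_apply (1 : G), LinearMap.sum_apply, map_sum]
    refine Eq.trans ?_ h1
    rw [← Finset.univ_sum_single (p s), map_sum]
    rfl

/-- On a pulled-back section the conjugate has value `τ(k) (a f)(k)` at `1`. Left invariance moves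
the agreement of `a` and `D` from `1` to `k`, and equivariance of `D s` brings it back to `1`. Hence
averaging over `K` does not alter the value at `1`. -/
lemma opConj_apply_one {τ : K →* (V ≃ₗᵢ[ℂ] V)} {D : Module.End ℂ (SmoothSections E τ)}
    (hD : IsInvariantDifferentialOperator D) {n : ℕ} {a : Module.End ℂ (smoothFunctions E G V)}
    (ha : a ∈ invOp E G V n)
    (haD : ∀ s, (a (pullbackSmooth τ s)).1 1 = (pullbackSmooth τ (D s)).1 1)
    (s : SmoothSections E τ) (k : K) :
    (opConj E τ k a (pullbackSmooth τ s)).1 1 = (pullbackSmooth τ (D s)).1 1 := by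
  have h1 : (a (pullbackSmooth τ s)).1 k = (pullbackSmooth τ (D s)).1 k := by
    rw [apply_eq_apply_one ha, pullback_apply_of_invariant hD, ← haD,
      pullbackSmooth_translateSmooth, inv_inv]
  have h2 : (rightAction E τ k (pullbackSmooth τ (D s))).1 1 = (pullbackSmooth τ (D s)).1 1 := by
    rw [rightAction_pullbackSmooth]
  rw [opConj_pullbackSmooth, ← h2, rightAction_apply, rightAction_apply, one_mul, h1]

set_option maxHeartbeats 1600000 in
lemma exists_invariant_op_eq_at_one [IsTopologicalGroup G] [CompactSpace K]
    {τ : K →* (V ≃ₗᵢ[ℂ] V)} (hτ : ∀ v, Continuous fun k => τ k v)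
    {D : Module.End ℂ (SmoothSections E τ)} (hD : IsInvariantDifferentialOperator D) :
    ∃ n, ∃ u ∈ invOp E G V n, (∀ k, opConj E τ k u = u) ∧
      ∀ s, (u (pullbackSmooth τ s)).1 1 = (pullbackSmooth τ (D s)).1 1 := by
  obtain ⟨n, a, ha, haD⟩ := exists_invOp_eq_at_one hD.1
  obtain ⟨u, hu, hinv, havg⟩ := exists_invariant_average (σ := opConj E τ)
    lieOp_commute (opConj_constOp_mem hτ) (fun _ => opConj_lieOp_mem τ _)
    (AlgHom.id ℂ (Module.End ℂ (smoothFunctions E G V))) (evalAt (1 : G)) ha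
  exact ⟨n, u, hu, hinv, fun s => havg _ _ (opConj_apply_one hD ha haD s)⟩

/-- The averaged operator and `D` agree at `1`, and both commute with left translations, so they
agree everywhere. -/
theorem exists_toSections_eq [IsTopologicalGroup G] [CompactSpace K] {τ : K →* (V ≃ₗᵢ[ℂ] V)}
    (hτ : ∀ v, Continuous fun k => τ k v) {D : Module.End ℂ (SmoothSections E τ)}
    (hD : IsInvariantDifferentialOperator D) : ∃ a, toSections τ a = D := by
  obtain ⟨n, u, hu, hinv, hone⟩ := exists_invariant_op_eq_at_one hτ hD
  refine ⟨⟨u, ⟨n, hu⟩, hinv⟩, ext_pullbackSmooth fun s => smoothFunctions_ext fun g => ?_⟩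
  rw [pullbackSmooth_toSections]
  change (u (pullbackSmooth τ s)).1 g = _
  rw [apply_eq_apply_one hu, pullback_apply_of_invariant hD, ← hone,
    pullbackSmooth_translateSmooth, inv_inv]

end Sections

end InvDiffOp
end

theorem mainTheorem7 {E : Type*} [NormedAddCommGroup E] [NormedSpace ℝ E] [FiniteDimensional ℝ E]
    {G : Type*} [TopologicalSpace G] [ChartedSpace E G] [Group G] [LieGroup 𝓘(ℝ, E) ∞ G]
    [T2Space G] [ConnectedSpace G] (hG : InvDiffOp.IsSemisimpleLieGroup E G)
    (hZ : Finite (Subgroup.center G))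
    (K : Subgroup G) (hK : Maximal (fun L : Subgroup G => IsCompact (L : Set G)) K)
    {V : Type*} [NormedAddCommGroup V] [InnerProductSpace ℂ V] [CompleteSpace V]
    (τ : K →* (V ≃ₗᵢ[ℂ] V)) (hτ : InvDiffOp.IsIrreducibleUnitaryRep τ) :
    ∃ 𝒟 : Subalgebra ℂ (Module.End ℂ (InvDiffOp.SmoothSections E τ)),
      (∀ D : Module.End ℂ (InvDiffOp.SmoothSections E τ),
        D ∈ 𝒟 ↔ InvDiffOp.IsInvariantDifferentialOperator D) ∧
        𝒟.FG := by
  have : IsTopologicalGroup G := topologicalGroup_of_lieGroup 𝓘(ℝ, E) ∞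
  have : CompactSpace K := isCompact_iff_compactSpace.1 hK.prop
  have := hτ.finiteDimensional
  refine ⟨(InvDiffOp.toSections τ).range, fun D => ⟨?_, fun hD => ?_⟩, ?_⟩
  · rintro ⟨a, rfl⟩
    exact InvDiffOp.isInvariantDifferentialOperator_toSections τ a
  · exact InvDiffOp.exists_toSections_eq hτ.continuous_apply hD
  · have hfg : (InvDiffOp.invariantOps E τ).FG := InvDiffOp.fg_filInvariants _ _
      (fun i j => InvDiffOp.lieOp_commutator_mem _ _)
      (InvDiffOp.opConj_constOp_mem hτ.continuous_apply)
      (fun i => InvDiffOp.opConj_lieOp_mem τ _)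
    rw [← Algebra.map_top]
    exact ((Subalgebra.fg_top _).2 hfg).map _
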